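/- A parameterized problem is a set of pairs $(w,k)$ of a word $w$ (a finite sequence of natural numbers written in binary) and a parameter $k\in\mathbb{N}$. A parameterized reduction from $P$ to $Q$ is a map $(w,k)\mapsto(w',k')$ such that $(w,k)\in P\iff(w',k')\in Q$, which is computed by a random access machine in time $f(k)\cdot|w|^{O(1)}$ and satisfies $k'\le g(k)$, for some computable functions $f,g$. The class $\mathrm{W}[1]$ consists of all parameterized problems that have a parameterized reduction to Short Turing Machine Acceptance (given a nondeterministic single-tape Turing machine $M$, a string $x$ and the parameter $k$, does $M$ accept $x$ in at most $k$ steps?), and a problem $Q$ is $\mathrm{W}[1]$-hard if every problem in $\mathrm{W}[1]$ has a parameterized reduction to $Q$. For a class $\mathcal{H}$ of finite directed graphs (patterns), $\mathcal{H}$-DSN (Directed Steiner $\mathcal{H}$-Network) is the following problem, stated as a decision problem: given a directed graph $G$ with arc weights in $\mathbb{N}$, a set $R\subseteq V(G)$ of terminals, a directed graph $H\in\mathcal{H}$ with vertex set $R$, and a number $C\in\mathbb{N}$, is there a subgraph $N\subseteq G$ of total arc weight at most $C$ that contains a directed path from $s$ to $t$ for every edge $st\in E(H)$? For $\alpha\ge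 1$, the flawed $\alpha$-out-diamond is the directed graph on $\alpha+3$ distinct vertices $r_1,r_2,x,\ell_1,\dots,\ell_\alpha$ whose edges are $r_i\ell_j$ for $i\in\{1,2\}$, $1\le j\le\alpha$, together with $xr_1$ and $xr_2$. The flawed $\alpha$-in-diamond is obtained from it by reversing all edges, that is, its edges are $\ell_jr_i$, $r_1x$ and $r_2x$. **Lemma.** If $\mathcal{H}$ is the class of all flawed out-diamonds (the flawed $\alpha$-out-diamonds for all $\alpha\ge 1$, up to isomorphism), then $\mathcal{H}$-DSN is $\mathrm{W}[1]$-hard parameterized by the number $k=|R|$ of terminals. The same holds if $\mathcal{H}$ is the class of all flawed in-diamonds. -/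

import Mathlib

/-! ## Random access machines with uniform cost

A structured random access machine with a read-only input, an addressable memory of natural
numbers (all cells initially `0`, with indirect addressing) and a write-only output.  The only
arithmetic operations are addition, truncated subtraction and halving, so under the uniform cost
measure it is polynomially equivalent to Turing machines. -/

/-- Arithmetic expressions of the machine. -/
inductive RAMExpr : Type
  /-- a constant -/
  | const (a : ℕ)
  /-- the content of the memory cell whose address is given by an expression -/
  | mem (addr : RAMExpr)
  /-- the number of items of the input -/
  | inputLen
  /-- the input item at a given (zero-based) position; `0` outside of the input -/
  | input (pos : RAMExpr)
  | add (e₁ e₂ : RAMExpr)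
  /-- truncated subtraction -/
  | sub (e₁ e₂ : RAMExpr)
  /-- division by two, rounded down -/
  | half (e : RAMExpr)

/-- Programs of the machine; conditions are read as "the value is not `0`". -/
inductive RAMProg : Type
  /-- `mem[addr] := val` -/
  | store (addr val : RAMExpr)
  /-- append a value to the output -/
  | write (val : RAMExpr)
  | seq (p q : RAMProg)
  | ite (cond : RAMExpr) (p q : RAMProg)
  | while (cond : RAMExpr) (p : RAMProg)

/-- The state of the machine: the memory and the output written so far. -/
structure RAMState : Type where
  mem : ℕ → ℕ
  output : List ℕ

/-- The initial state: zero memory, empty output. -/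
def RAMState.init : RAMState := ⟨fun _ => 0, []⟩

/-- The value of an expression on a given input and memory. -/
def RAMExpr.eval (inp : List ℕ) (m : ℕ → ℕ) : RAMExpr → ℕ
  | .const a => a
  | .mem e => m (e.eval inp m)
  | .inputLen => inp.length
  | .input e => inp.getD (e.eval inp m) 0
  | .add e₁ e₂ => e₁.eval inp m + e₂.eval inp m
  | .sub e₁ e₂ => e₁.eval inp m - e₂.eval inp m
  | .half e => e.eval inp m / 2

/-- `RAMExec inp p s t s'`: on input `inp`, the program `p` started in state `s` halts after
exactly `t` steps in state `s'`.  Each store, each write and each test of a condition is one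
step. -/
inductive RAMExec (inp : List ℕ) : RAMProg → RAMState → ℕ → RAMState → Prop
  | store (addr val : RAMExpr) (s : RAMState) :
      RAMExec inp (.store addr val) s 1
        ⟨Function.update s.mem (addr.eval inp s.mem) (val.eval inp s.mem), s.output⟩
  | write (val : RAMExpr) (s : RAMState) :
      RAMExec inp (.write val) s 1 ⟨s.mem, s.output ++ [val.eval inp s.mem]⟩
  | seq {p q : RAMProg} {s s' s'' : RAMState} {t t' : ℕ}
      (hp : RAMExec inp p s t s') (hq : RAMExec inp q s' t' s'') :
      RAMExec inp (.seq p q) s (t + t') s''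
  | iteTrue {cond : RAMExpr} {p q : RAMProg} {s s' : RAMState} {t : ℕ}
      (hc : cond.eval inp s.mem ≠ 0) (hp : RAMExec inp p s t s') :
      RAMExec inp (.ite cond p q) s (t + 1) s'
  | iteFalse {cond : RAMExpr} {p q : RAMProg} {s s' : RAMState} {t : ℕ}
      (hc : cond.eval inp s.mem = 0) (hq : RAMExec inp q s t s') :
      RAMExec inp (.ite cond p q) s (t + 1) s'
  | whileTrue {cond : RAMExpr} {p : RAMProg} {s s' s'' : RAMState} {t t' : ℕ}
      (hc : cond.eval inp s.mem ≠ 0) (hp : RAMExec inp p s t s')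
      (hw : RAMExec inp (.while cond p) s' t' s'') :
      RAMExec inp (.while cond p) s (t + t' + 1) s''
  | whileFalse {cond : RAMExpr} {p : RAMProg} {s : RAMState}
      (hc : cond.eval inp s.mem = 0) :
      RAMExec inp (.while cond p) s 1 s

/-! ## Parameterized problems and parameterized reductions -/

/-- A parameterized problem: a set of pairs `(w, k)` of a word `w` (a finite sequence of natural
numbers, each of them written in binary) and a parameter `k`. -/
abbrev ParamProblem : Type := Set (List ℕ × ℕ)

/-- The size of a word: the total length of the binary representations of its items, plus one
separator for each item. -/
def wordSize (w : List ℕ) : ℕ := (w.map fun a => a.size + 1).sum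

/-- A parameterized (many-one) reduction: some program maps every `(w, k)` to an equivalent
`(w', k')` in time `f k * |w| ^ O(1)`, where `k' ≤ g k`, for computable functions `f` and `g`.
The program receives the sequence `k, w` and outputs the sequence `k', w'`. -/
def FPTReducible (P Q : ParamProblem) : Prop :=
  ∃ (p : RAMProg) (f g : ℕ → ℕ) (c : ℕ), Computable f ∧ Computable g ∧
    ∀ (w : List ℕ) (k : ℕ), ∃ (w' : List ℕ) (k' t : ℕ) (m : ℕ → ℕ),
      RAMExec (k :: w) p RAMState.init t ⟨m, k' :: w'⟩ ∧
      t ≤ f k * (wordSize w + 1) ^ c ∧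
      k' ≤ g k ∧
      ((w, k) ∈ P ↔ (w', k') ∈ Q)

/-! ## Short Turing machine acceptance and the class W[1] -/

/-- A transition of a nondeterministic single-tape Turing machine; states and tape symbols are
natural numbers. -/
structure NTMTransition : Type where
  state : ℕ
  read : ℕ
  newState : ℕ
  write : ℕ
  /-- the head movement: `0` is left, `1` is right, anything else is "stay" -/
  move : ℕ

/-- A nondeterministic single-tape Turing machine; the tape symbol `0` is the blank. -/
structure NTM : Type where
  start : ℕ
  accept : ℕ
  transitions : List NTMTransition

/-- A configuration, with a two-way infinite tape. -/
structure NTMConfig : Type where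
  state : ℕ
  head : ℤ
  tape : ℤ → ℕ

/-- The displacement of the head. -/
def NTMTransition.shift (τ : NTMTransition) : ℤ :=
  if τ.move = 0 then -1 else if τ.move = 1 then 1 else 0

/-- The initial configuration: `x` stands on the cells `0, …, |x| - 1`, all other cells are
blank, the head is on cell `0`. -/
def NTM.initial (M : NTM) (x : List ℕ) : NTMConfig where
  state := M.start
  head := 0
  tape := fun i => if 0 ≤ i then x.getD i.toNat 0 else 0

/-- One step of the machine. -/
def NTM.Step (M : NTM) (c c' : NTMConfig) : Prop :=
  ∃ τ ∈ M.transitions, τ.state = c.state ∧ τ.read = c.tape c.head ∧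
    c' = ⟨τ.newState, c.head + τ.shift, Function.update c.tape c.head τ.write⟩

/-- `M` has a computation on `x` that reaches the accepting state after at most `k` steps. -/
def NTM.AcceptsWithin (M : NTM) (x : List ℕ) (k : ℕ) : Prop :=
  ∃ (j : ℕ) (c : ℕ → NTMConfig), j ≤ k ∧ c 0 = M.initial x ∧
    (∀ i < j, M.Step (c i) (c (i + 1))) ∧ (c j).state = M.accept

/-- Reading a list of transitions, five numbers each, from a word. -/
def decodeTransitions : List ℕ → List NTMTransition
  | q :: a :: q' :: b :: d :: w => ⟨q, a, q', b, d⟩ :: decodeTransitions w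
  | _ => []

/-- The parameterized problem Short Turing Machine Acceptance: given a nondeterministic
single-tape Turing machine `M`, a string `x` and the parameter `k`, does `M` accept `x` in at
most `k` steps?  The instance is written as the start state, the accepting state, the length of
`x`, the symbols of `x`, and the transitions. -/
def shortTMAcceptance : ParamProblem :=
  {p | ∃ (q₀ qₐ : ℕ) (x w : List ℕ), p.1 = q₀ :: qₐ :: x.length :: (x ++ w) ∧
    (NTM.mk q₀ qₐ (decodeTransitions w)).AcceptsWithin x p.2}

/-- The class W[1]: the parameterized problems that are reducible to Short Turing Machine
Acceptance. -/
def classWOne : Set ParamProblem := {P | FPTReducible P shortTMAcceptance}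

/-- W[1]-hardness: every problem of W[1] has a parameterized reduction to `Q`. -/
def IsWOneHard (Q : ParamProblem) : Prop := ∀ P ∈ classWOne, FPTReducible P Q

/-! ## Directed Steiner Network -/

/-- An instance of (the decision version of) Directed Steiner Network on the vertex set
`{0, …, n - 1}`: an arc-weighted directed graph, terminals, a pattern graph on the terminals, and
a bound on the cost. -/
structure DSNInstance : Type where
  n : ℕ
  /-- `arc u v = some c` if there is an arc from `u` to `v`, of weight `c`; `none` if not -/
  arc : Fin n → Fin n → Option ℕ
  terminals : Finset (Fin n)
  pattern : Digraph {v : Fin n // v ∈ terminals}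
  budget : ℕ

/-- The set `N` of arcs forms a solution: all arcs belong to the graph, and `N` contains a path
from `s` to `t` for each edge `st` of the pattern. -/
def DSNInstance.IsSolution (I : DSNInstance) (N : Finset (Fin I.n × Fin I.n)) : Prop :=
  (∀ e ∈ N, (I.arc e.1 e.2).isSome) ∧
    ∀ s t : {v : Fin I.n // v ∈ I.terminals}, I.pattern.Adj s t →
      Relation.ReflTransGen (fun u v => (u, v) ∈ N) s.1 t.1

/-- The cost of a set of arcs. -/
def DSNInstance.cost (I : DSNInstance) (N : Finset (Fin I.n × Fin I.n)) : ℕ :=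
  ∑ e ∈ N, (I.arc e.1 e.2).getD 0

/-- There is a solution of cost at most the budget. -/
def DSNInstance.Feasible (I : DSNInstance) : Prop :=
  ∃ N : Finset (Fin I.n × Fin I.n), I.IsSolution N ∧ I.cost N ≤ I.budget

/-- The entries of an `n × n` matrix, row by row. -/
def matrixWord {n : ℕ} (A : Fin n → Fin n → ℕ) : List ℕ :=
  (List.ofFn fun u => List.ofFn (A u)).flatten

open Classical in
/-- An instance as a word: the number of vertices, the budget, the indicator vector of the
terminals, the adjacency matrix of the pattern, and the weight matrix of the graph, with entry
`0` for a missing arc and `c + 1` for an arc of weight `c`. -/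
noncomputable def DSNInstance.encode (I : DSNInstance) : List ℕ :=
  I.n :: I.budget ::
    ((List.ofFn fun v => if v ∈ I.terminals then 1 else 0) ++
      matrixWord (fun u v =>
        if ∃ (hu : u ∈ I.terminals) (hv : v ∈ I.terminals), I.pattern.Adj ⟨u, hu⟩ ⟨v, hv⟩
        then 1 else 0) ++
      matrixWord (fun u v => (I.arc u v).elim 0 (· + 1)))

/-- A class of pattern graphs. -/
abbrev PatternClass : Type 1 := (V : Type) → Digraph V → Prop

/-- Directed Steiner Network restricted to patterns of the class `H`, parameterized by the number
of terminals. -/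
def dsnProblem (H : PatternClass) : ParamProblem :=
  {p | ∃ I : DSNInstance, H _ I.pattern ∧ p.1 = I.encode ∧ p.2 = I.terminals.card ∧ I.Feasible}

/-! ## Flawed diamonds -/

/-- The vertices of a flawed `α`-diamond: two roots, `α` leaves and the additional vertex `x`. -/
inductive FlawedDiamondVertex (α : ℕ) : Type
  | root (i : Fin 2)
  | leaf (l : Fin α)
  | x

/-- The flawed `α`-out-diamond: an edge from each root to each leaf, and an edge from `x` to each
root. -/
def flawedOutDiamond (α : ℕ) : Digraph (FlawedDiamondVertex α) where
  Adj
    | .root _, .leaf _ => True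
    | .x, .root _ => True
    | _, _ => False

/-- The flawed `α`-in-diamond: an edge from each leaf to each root, and an edge from each root to
`x`. -/
def flawedInDiamond (α : ℕ) : Digraph (FlawedDiamondVertex α) where
  Adj
    | .leaf _, .root _ => True
    | .root _, .x => True
    | _, _ => False

/-- The class of all digraphs isomorphic to a flawed `α`-out-diamond for some `α ≥ 1`. -/
def flawedOutDiamonds : PatternClass := fun _ H =>
  ∃ α : ℕ, 1 ≤ α ∧ Nonempty (H.Adj ≃r (flawedOutDiamond α).Adj)

/-- The class of all digraphs isomorphic to a flawed `α`-in-diamond for some `α ≥ 1`. -/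
def flawedInDiamonds : PatternClass := fun _ H =>
  ∃ α : ℕ, 1 ≤ α ∧ Nonempty (H.Adj ≃r (flawedInDiamond α).Adj)

/-! ## Emission programs -/

/-! Every problem of W[1] reduces to Short Turing Machine Acceptance by definition. That problem is
reduced to `tableauProblem` (`shortTMAcceptance_reducible`), which in turn is reduced to the two
Steiner problems (`tableauProblem_reducible_out`, `tableauProblem_reducible_in`);
`FPTReducible.trans` composes the steps.

`tableauProblem` is a constraint problem with binary constraints: one row is chosen for each time
`0, …, k`, and any two chosen rows must fit together. Consistency of the tape becomes a binary
constraint because each row guesses when its cell was last visited: the row of that time must have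
written the symbol now read, and all rows in between must stand on other cells. Idle rows fill the
time after halting (`NTM.acceptsWithin_iff_rows`).

With `K = k + 1`, the network has a leaf `(i, j)` for each pair of times. Root 1 buys arcs to
vertices `(a, 0)`, root 2 buys arcs to vertices `(0, b)`; both continue for free to `(a, b)`, from
where an arc of weight one enters the leaf of the times of `a` and `b`, provided that `a` and `b`
are linked. Every solution pays for `K` arcs at each root and for one arc into each of the `K * K`
leaves. The budget `2 * K + K * K` therefore leaves exactly one arc of each kind, so the two roots
must share the arc into a leaf. This yields choices `c`, `d` with `c i` linked to `d j` for all `i`,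
`j` (`Grid.choice_of_cheap`); the diagonal links force `c = d`, the others are the compatibility
constraints. The terminal `x` reaches the roots at no cost and does not affect the argument.
In-diamonds follow by reversing all arcs.

Running times are controlled by a small loop language, `EmitProg`, whose programs run in time
polynomial in their loop bounds (`EmitProg.exec_compile`, `EmitProg.time_le`). -/

/-- The memory that holds a list of values in its first cells. -/
def envMem (env : List ℕ) : ℕ → ℕ := fun i => env.getD i 0

/-- Programs built from output commands, bounded loops and local definitions.  Variables are
numbered by their nesting level; a loop bound is the value of an earlier variable. -/
inductive EmitProg : Type
  | skip
  | write (e : RAMExpr)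
  | seq (A B : EmitProg)
  | ite (c : RAMExpr) (A B : EmitProg)
  | letVal (e : RAMExpr) (A : EmitProg)
  /-- bind a new variable to the product of two variables -/
  | letMul (i j : ℕ) (A : EmitProg)
  /-- a loop whose new variable runs through the values below that of variable `i` -/
  | loop (i : ℕ) (A : EmitProg)

namespace EmitProg

/-- The output of a program in an environment. -/
def out (inp : List ℕ) : EmitProg → List ℕ → List ℕ
  | skip, _ => []
  | write e, env => [e.eval inp (envMem env)]
  | seq A B, env => A.out inp env ++ B.out inp env
  | ite c A B, env => if c.eval inp (envMem env) ≠ 0 then A.out inp env else B.out inp env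
  | letVal e A, env => A.out inp (env ++ [e.eval inp (envMem env)])
  | letMul i j A, env => A.out inp (env ++ [envMem env i * envMem env j])
  | loop i A, env => (List.range (envMem env i)).flatMap fun v => A.out inp (env ++ [v])

/-- All loop bounds refer to variables that are in scope. -/
def WellScoped : EmitProg → ℕ → Prop
  | skip, _ => True
  | write _, _ => True
  | seq A B, d => A.WellScoped d ∧ B.WellScoped d
  | ite _ A B, d => A.WellScoped d ∧ B.WellScoped d
  | letVal _ A, d => A.WellScoped (d + 1)
  | letMul i j A, d => i < d ∧ j < d ∧ A.WellScoped (d + 1)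
  | loop i A, d => i < d ∧ A.WellScoped (d + 1)

/-- All loop bounds that occur are at most `B`. -/
def LoopsLE (inp : List ℕ) (b : ℕ) : EmitProg → List ℕ → Prop
  | skip, _ => True
  | write _, _ => True
  | seq A B, env => A.LoopsLE inp b env ∧ B.LoopsLE inp b env
  | ite c A B, env =>
      (c.eval inp (envMem env) ≠ 0 → A.LoopsLE inp b env) ∧ B.LoopsLE inp b env
  | letVal e A, env => A.LoopsLE inp b (env ++ [e.eval inp (envMem env)])
  | letMul i j A, env =>
      envMem env i ≤ b ∧ A.LoopsLE inp b (env ++ [envMem env i * envMem env j])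
  | loop i A, env =>
      envMem env i ≤ b ∧ ∀ v < envMem env i, A.LoopsLE inp b (env ++ [v])

/-- The running time when all loop bounds are at most `b`. -/
def time (b : ℕ) : EmitProg → ℕ
  | skip => 1
  | write _ => 1
  | seq A B => A.time b + B.time b
  | ite _ A B => A.time b + B.time b + 1
  | letVal _ A => A.time b + 2
  | letMul _ _ A => A.time b + 3 * b + 3
  | loop _ A => b * (A.time b + 2) + 2

/-- The number of commands. -/
def size : EmitProg → ℕ
  | skip => 1
  | write _ => 1
  | seq A B => A.size + B.size
  | ite _ A B => A.size + B.size + 1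
  | letVal _ A => A.size + 1
  | letMul _ _ A => A.size + 1
  | loop _ A => A.size + 1

/-- Translation to a random access machine; `d` is the number of variables in scope. -/
def compile : EmitProg → ℕ → RAMProg
  | skip, d => .store (.const d) (.const 0)
  | write e, _ => .write e
  | seq A B, d => .seq (A.compile d) (B.compile d)
  | ite c A B, d => .ite c (A.compile d) (B.compile d)
  | letVal e A, d =>
      .seq (.store (.const d) e) (.seq (A.compile (d + 1)) (.store (.const d) (.const 0)))
  | letMul i j A, d =>
      .seq (.while (.sub (.mem (.const i)) (.mem (.const (d + 1))))
          (.seq (.store (.const d) (.add (.mem (.const d)) (.mem (.const j))))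
            (.store (.const (d + 1)) (.add (.mem (.const (d + 1))) (.const 1)))))
        (.seq (.store (.const (d + 1)) (.const 0))
          (.seq (A.compile (d + 1)) (.store (.const d) (.const 0))))
  | loop i A, d =>
      .seq (.while (.sub (.mem (.const i)) (.mem (.const d)))
          (.seq (A.compile (d + 1)) (.store (.const d) (.add (.mem (.const d)) (.const 1)))))
        (.store (.const d) (.const 0))

theorem one_le_size (A : EmitProg) : 1 ≤ A.size := by
  cases A <;> simp only [size] <;> first | omega | skip
  rename_i A B; have : 1 ≤ A.size := one_le_size A; omega

/-- Each constructor costs at most one more factor `b + 5`, so the exponent depends on the program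
only. -/
theorem time_le (b : ℕ) (A : EmitProg) : A.time b ≤ (b + 5) ^ A.size := by
  have key : ∀ m n : ℕ, 1 ≤ m → 1 ≤ n →
      (b + 5) ^ m + (b + 5) ^ n + 1 ≤ (b + 5) ^ (m + n) * 1 := by
    intro m n hm hn
    have h1 : b + 5 ≤ (b + 5) ^ m := Nat.le_self_pow (by omega) _
    have h2 : b + 5 ≤ (b + 5) ^ n := Nat.le_self_pow (by omega) _
    rw [pow_add]; nlinarith
  induction A with
  | skip => simp [time, size]
  | write e => simp [time, size]
  | seq A B hA hB =>
    have := key _ _ A.one_le_size B.one_le_size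
    simp only [time, size]; omega
  | ite c A B hA hB =>
    have h := key _ _ A.one_le_size B.one_le_size
    have h2 : (b + 5) ^ (A.size + B.size) ≤ (b + 5) ^ (A.size + B.size + 1) :=
      Nat.pow_le_pow_right (by omega) (by omega)
    simp only [time, size]; omega
  | letVal e A hA =>
    have h1 : b + 5 ≤ (b + 5) ^ A.size := Nat.le_self_pow (by have := A.one_le_size; omega) _
    simp only [time, size, pow_succ]; nlinarith
  | letMul i j A hA =>
    have h1 : b + 5 ≤ (b + 5) ^ A.size := Nat.le_self_pow (by have := A.one_le_size; omega) _
    simp only [time, size, pow_succ]; nlinarith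
  | loop i A hA =>
    have h1 : b + 5 ≤ (b + 5) ^ A.size := Nat.le_self_pow (by have := A.one_le_size; omega) _
    simp only [time, size, pow_succ]; nlinarith

end EmitProg

theorem envMem_append_left {env : List ℕ} {i : ℕ} (h : i < env.length) (l : List ℕ) :
    envMem (env ++ l) i = envMem env i := by
  simp [envMem, List.getD_eq_getElem?_getD, List.getElem?_append_left h]

theorem envMem_append_length (env l : List ℕ) :
    envMem (env ++ l) env.length = l.getD 0 0 := by
  simp [envMem, List.getD_eq_getElem?_getD, List.getElem?_append_right le_rfl]

theorem update_envMem_append (env : List ℕ) (v w : ℕ) (l : List ℕ) :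
    Function.update (envMem (env ++ v :: l)) env.length w = envMem (env ++ w :: l) := by
  funext i
  simp only [Function.update_apply, envMem, List.getD_eq_getElem?_getD]
  rcases lt_trichotomy i env.length with h | h | h
  · rw [List.getElem?_append_left h, List.getElem?_append_left h, if_neg h.ne]
  · simp [h]
  · obtain ⟨j, rfl⟩ : ∃ j, i = env.length + 1 + j := ⟨i - env.length - 1, by omega⟩
    rw [List.getElem?_append_right (by omega), List.getElem?_append_right (by omega),
      if_neg (by omega)]
    have : env.length + 1 + j - env.length = j + 1 := by omega
    simp [this]

/-- Memory is zero beyond the environment, so a trailing zero is invisible. A local variable thus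
goes out of scope by being cleared. -/
theorem envMem_append_zero (env : List ℕ) : envMem (env ++ [0]) = envMem env := by
  funext i
  simp only [envMem, List.getD_eq_getElem?_getD, List.getElem?_append]
  split
  · rfl
  · rename_i h
    rw [List.getElem?_eq_none (l := env) (by omega)]
    cases h' : i - env.length <;> simp

theorem update_envMem (env : List ℕ) (v : ℕ) :
    Function.update (envMem env) env.length v = envMem (env ++ [v]) := by
  rw [← envMem_append_zero env, update_envMem_append]

theorem update_envMem_zero (env : List ℕ) (v : ℕ) :
    Function.update (envMem (env ++ [v])) env.length 0 = envMem env := by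
  rw [update_envMem_append, envMem_append_zero]

namespace EmitProg

/-- Induction on the number `r` of remaining rounds. The first free cell is the counter; the body
runs with it as its newest variable and leaves it unchanged. -/
theorem exec_loop {inp : List ℕ} {P : RAMProg} {env : List ℕ} {i n T : ℕ}
    {out : ℕ → List ℕ} (hi : i < env.length) (hn : envMem env i = n)
    (hP : ∀ v < n, ∀ o, ∃ t ≤ T, RAMExec inp P ⟨envMem (env ++ [v]), o⟩ t
      ⟨envMem (env ++ [v]), o ++ out v⟩) (r : ℕ) (o : List ℕ) (v : ℕ) (hv : v + r = n) :
    ∃ t ≤ r * (T + 2) + 1, RAMExec inp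
      (.while (.sub (.mem (.const i)) (.mem (.const env.length)))
        (.seq P (.store (.const env.length) (.add (.mem (.const env.length)) (.const 1)))))
      ⟨envMem (env ++ [v]), o⟩ t
      ⟨envMem (env ++ [n]), o ++ (List.range' v r).flatMap out⟩ := by
  induction r generalizing v o with
  | zero =>
    obtain rfl : v = n := by omega
    refine ⟨1, by omega, ?_⟩
    simp only [List.range'_zero, List.flatMap_nil, List.append_nil]
    apply RAMExec.whileFalse
    simp [RAMExpr.eval, envMem_append_left hi, hn, envMem_append_length]
  | succ r ih =>
    obtain ⟨t₁, ht₁, h₁⟩ := hP v (by omega) o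
    obtain ⟨t₂, ht₂, h₂⟩ := ih (o ++ out v) (v + 1) (by omega)
    refine ⟨t₁ + 1 + t₂ + 1, by rw [Nat.succ_mul]; omega, ?_⟩
    rw [List.range'_succ, List.flatMap_cons, ← List.append_assoc]
    refine RAMExec.whileTrue ?_ (RAMExec.seq h₁ (RAMExec.store _ _ _)) ?_
    · simp [RAMExpr.eval, envMem_append_left hi, hn, envMem_append_length]; omega
    · simpa [RAMExpr.eval, envMem_append_length, update_envMem_append] using h₂

/-- Multiplication by repeated addition: the first free cell accumulates, the second one counts. -/
theorem exec_mul {inp : List ℕ} {env : List ℕ} {i j n : ℕ}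
    (hi : i < env.length) (hj : j < env.length) (hn : envMem env i = n)
    (o : List ℕ) (r : ℕ) (v : ℕ) (hv : v + r = n) :
    RAMExec inp
      (.while (.sub (.mem (.const i)) (.mem (.const (env.length + 1))))
        (.seq (.store (.const env.length) (.add (.mem (.const env.length)) (.mem (.const j))))
          (.store (.const (env.length + 1))
            (.add (.mem (.const (env.length + 1))) (.const 1)))))
      ⟨envMem (env ++ [v * envMem env j, v]), o⟩ (3 * r + 1)
      ⟨envMem (env ++ [n * envMem env j, n]), o⟩ := by
  have hlast : ∀ a b : ℕ, envMem (env ++ [a, b]) (env.length + 1) = b := by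
    intro a b
    have := envMem_append_length (env ++ [a]) [b]
    simpa using this
  have hupd : ∀ a b c : ℕ, Function.update (envMem (env ++ [a, b])) (env.length + 1) c
      = envMem (env ++ [a, c]) := by
    intro a b c
    have := update_envMem_append (env ++ [a]) b c []
    simpa using this
  induction r generalizing v with
  | zero =>
    obtain rfl : v = n := by omega
    apply RAMExec.whileFalse
    simp [RAMExpr.eval, envMem_append_left hi, hn, hlast]
  | succ r ih =>
    have h₂ := ih (v + 1) (by omega)
    have : 3 * (r + 1) + 1 = (1 + 1) + (3 * r + 1) + 1 := by ring
    rw [this]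
    refine RAMExec.whileTrue ?_ (RAMExec.seq (RAMExec.store _ _ _) (RAMExec.store _ _ _)) ?_
    · simp [RAMExpr.eval, envMem_append_left hi, hn, hlast]; omega
    · simpa [RAMExpr.eval, envMem_append_length, update_envMem_append, hlast, hupd,
        envMem_append_left hj, Nat.succ_mul] using h₂

/-- The invariant is that all cells beyond the variables in scope are zero, before and after. Each
construct can therefore use the next cells as fresh counters, and has to clear them at the end. -/
theorem exec_compile {inp : List ℕ} {b : ℕ} (A : EmitProg) (env o : List ℕ)
    (hs : A.WellScoped env.length) (hb : A.LoopsLE inp b env) :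
    ∃ t ≤ A.time b, RAMExec inp (A.compile env.length) ⟨envMem env, o⟩ t
      ⟨envMem env, o ++ A.out inp env⟩ := by
  induction A generalizing env o with
  | skip =>
    -- The machine has no idle command; storing `0` in the first free cell changes nothing.
    refine ⟨1, le_rfl, ?_⟩
    have := RAMExec.store (inp := inp) (.const env.length) (.const 0) ⟨envMem env, o⟩
    simpa [RAMExpr.eval, out, compile, update_envMem, envMem_append_zero] using this
  | write e => exact ⟨1, le_rfl, RAMExec.write _ _⟩
  | seq A B hA hB =>
    obtain ⟨t₁, ht₁, h₁⟩ := hA env o hs.1 hb.1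
    obtain ⟨t₂, ht₂, h₂⟩ := hB env (o ++ A.out inp env) hs.2 hb.2
    refine ⟨t₁ + t₂, Nat.add_le_add ht₁ ht₂, ?_⟩
    simp only [out, ← List.append_assoc]
    exact RAMExec.seq h₁ h₂
  | ite c A B hA hB =>
    by_cases hc : c.eval inp (envMem env) = 0
    · obtain ⟨t₂, ht₂, h₂⟩ := hB env o hs.2 hb.2
      refine ⟨t₂ + 1, by simp only [time]; omega, ?_⟩
      simp only [out, hc, ne_eq, not_true_eq_false, if_false]
      exact RAMExec.iteFalse hc h₂
    · obtain ⟨t₁, ht₁, h₁⟩ := hA env o hs.1 (hb.1 hc)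
      refine ⟨t₁ + 1, by simp only [time]; omega, ?_⟩
      simp only [out, hc, ne_eq, not_false_eq_true, if_true]
      exact RAMExec.iteTrue hc h₁
  | letVal e A hA =>
    obtain ⟨t, ht, h⟩ := hA (env ++ [e.eval inp (envMem env)]) o
      (by simpa [WellScoped] using hs) hb
    refine ⟨1 + (t + 1), by simp only [time]; omega, ?_⟩
    refine RAMExec.seq (RAMExec.store _ _ _) (RAMExec.seq
      (s' := ⟨envMem (env ++ [e.eval inp (envMem env)]), o ++ (letVal e A).out inp env⟩) ?_ ?_)
    · simpa [RAMExpr.eval, update_envMem, out] using h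
    · have := RAMExec.store (inp := inp) (.const env.length) (.const 0)
        ⟨envMem (env ++ [e.eval inp (envMem env)]), o ++ (letVal e A).out inp env⟩
      simpa [RAMExpr.eval, update_envMem_zero] using this
  | letMul i j A hA =>
    have hz : envMem (env ++ [0, 0]) = envMem env := by
      have := envMem_append_zero (env ++ [0])
      rw [envMem_append_zero env, List.append_assoc] at this; exact this
    obtain ⟨t, ht, h⟩ := hA (env ++ [envMem env i * envMem env j]) o
      (by simpa using hs.2.2) hb.2
    have hm := exec_mul (inp := inp) hs.1 hs.2.1 rfl o (envMem env i) 0 (by simp)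
    simp only [Nat.zero_mul, hz] at hm
    have hb1 := hb.1
    refine ⟨(3 * envMem env i + 1) + (1 + (t + 1)), by simp only [time]; omega, ?_⟩
    refine RAMExec.seq hm (RAMExec.seq (RAMExec.store _ _ _) (RAMExec.seq
      (s' := ⟨envMem (env ++ [envMem env i * envMem env j]), o ++ (letMul i j A).out inp env⟩) ?_ ?_))
    · have := update_envMem_zero (env ++ [envMem env i * envMem env j]) (envMem env i)
      simp only [List.append_assoc, List.cons_append, List.nil_append, List.length_append,
        List.length_cons, List.length_nil, Nat.zero_add] at this
      simpa [RAMExpr.eval, this, out] using h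
    · have := RAMExec.store (inp := inp) (.const env.length) (.const 0)
        ⟨envMem (env ++ [envMem env i * envMem env j]), o ++ (letMul i j A).out inp env⟩
      simpa [RAMExpr.eval, update_envMem_zero] using this
  | loop i A hA =>
    have hP : ∀ v < envMem env i, ∀ o, ∃ t ≤ A.time b, RAMExec inp (A.compile (env.length + 1))
        ⟨envMem (env ++ [v]), o⟩ t ⟨envMem (env ++ [v]), o ++ A.out inp (env ++ [v])⟩ := by
      intro v hv o
      have := hA (env ++ [v]) o (by simpa using hs.2) (hb.2 v hv)
      simpa using this
    obtain ⟨t, ht, h⟩ := exec_loop hs.1 rfl hP (envMem env i) o 0 (by simp)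
    refine ⟨t + 1, ?_, RAMExec.seq (s' := ⟨envMem (env ++ [envMem env i]),
      o ++ (loop i A).out inp env⟩) ?_ ?_⟩
    · have := Nat.mul_le_mul_right (A.time b + 2) hb.1
      simp only [time]; omega
    · simpa [envMem_append_zero, out, List.range_eq_range'] using h
    · have := RAMExec.store (inp := inp) (.const env.length) (.const 0)
        ⟨envMem (env ++ [envMem env i]), o ++ (loop i A).out inp env⟩
      simpa [RAMExpr.eval, update_envMem_zero] using this

end EmitProg

/-! ## Composition of parameterized reductions -/

/-- Four times the value of an expression. -/
def RAMExpr.quad (e : RAMExpr) : RAMExpr := .add (.add e e) (.add e e)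

theorem RAMExpr.eval_quad (inp : List ℕ) (m : ℕ → ℕ) (e : RAMExpr) :
    e.quad.eval inp m = 4 * e.eval inp m := by
  simp only [quad, eval]; ring

/-- The expression over the memory cells divisible by four. -/
def RAMExpr.producer : RAMExpr → RAMExpr
  | const a => .const a
  | mem e => .mem e.producer.quad
  | inputLen => .inputLen
  | input e => .input e.producer
  | add e₁ e₂ => .add e₁.producer e₂.producer
  | sub e₁ e₂ => .sub e₁.producer e₂.producer
  | half e => .half e.producer

/-- The expression over the memory cells that are `2` modulo `4`, with the input taken from the
cells that are `1` modulo `4` and the length of the input from cell `3`. -/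
def RAMExpr.consumer : RAMExpr → RAMExpr
  | const a => .const a
  | mem e => .mem (.add e.consumer.quad (.const 2))
  | inputLen => .mem (.const 3)
  | input e => .mem (.add e.consumer.quad (.const 1))
  | add e₁ e₂ => .add e₁.consumer e₂.consumer
  | sub e₁ e₂ => .sub e₁.consumer e₂.consumer
  | half e => .half e.consumer

/-- The program with its memory moved to the cells divisible by four and its output written to
the cells that are `1` modulo `4`, with its length in cell `3`. -/
def RAMProg.producer : RAMProg → RAMProg
  | store a v => .store a.producer.quad v.producer
  | write v => .seq (.store (.add (RAMExpr.mem (.const 3)).quad (.const 1)) v.producer)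
      (.store (.const 3) (.add (.mem (.const 3)) (.const 1)))
  | seq p q => .seq p.producer q.producer
  | ite c p q => .ite c.producer p.producer q.producer
  | .while c p => .while c.producer p.producer

/-- The program that takes its input from the memory as left by `RAMProg.producer`. -/
def RAMProg.consumer : RAMProg → RAMProg
  | store a v => .store (.add a.consumer.quad (.const 2)) v.consumer
  | write v => .write v.consumer
  | seq p q => .seq p.consumer q.consumer
  | ite c p q => .ite c.consumer p.consumer q.consumer
  | .while c p => .while c.consumer p.consumer

/-- The state `S` represents the state `s` of a producer. -/
structure ProducerSim (s S : RAMState) : Prop where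
  mem : ∀ i, S.mem (4 * i) = s.mem i
  out : ∀ i, S.mem (4 * i + 1) = s.output.getD i 0
  free : ∀ i, S.mem (4 * i + 2) = 0
  len : S.mem 3 = s.output.length
  output : S.output = []

/-- The state `S` represents the state `s` of a consumer with input `inp`. -/
structure ConsumerSim (inp : List ℕ) (s S : RAMState) : Prop where
  mem : ∀ i, S.mem (4 * i + 2) = s.mem i
  data : ∀ i, S.mem (4 * i + 1) = inp.getD i 0
  len : S.mem 3 = inp.length
  output : S.output = s.output

theorem ProducerSim.eval {s S : RAMState} (h : ProducerSim s S) (inp : List ℕ) (e : RAMExpr) :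
    e.producer.eval inp S.mem = e.eval inp s.mem := by
  induction e with
  | mem e ih => simp only [RAMExpr.producer, RAMExpr.eval, RAMExpr.eval_quad, ih, h.mem]
  | _ => simp_all only [RAMExpr.producer, RAMExpr.eval]

theorem ConsumerSim.eval {inp : List ℕ} {s S : RAMState} (h : ConsumerSim inp s S)
    (inp' : List ℕ) (e : RAMExpr) :
    e.consumer.eval inp' S.mem = e.eval inp s.mem := by
  induction e with
  | mem e ih => simp only [RAMExpr.consumer, RAMExpr.eval, RAMExpr.eval_quad, ih, h.mem]
  | input e ih => simp only [RAMExpr.consumer, RAMExpr.eval, RAMExpr.eval_quad, ih, h.data]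
  | inputLen => simp only [RAMExpr.consumer, RAMExpr.eval, h.len]
  | _ => simp_all only [RAMExpr.consumer, RAMExpr.eval]

/-- Residues modulo four keep the regions of memory apart. Only `write` takes longer than before,
namely two stores, whence the factor `2`. -/
theorem ProducerSim.exec {inp : List ℕ} {p : RAMProg} {s s' : RAMState} {t : ℕ}
    (h : RAMExec inp p s t s') {S : RAMState} (hS : ProducerSim s S) :
    ∃ t' ≤ 2 * t, ∃ S', RAMExec inp p.producer S t' S' ∧ ProducerSim s' S' := by
  induction h generalizing S with
  | store a v s =>
    refine ⟨1, by omega, _, RAMExec.store _ _ _, ?_⟩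
    simp only [RAMExpr.eval_quad, hS.eval]
    refine ⟨fun i => ?_, fun i => ?_, fun i => ?_, ?_, hS.output⟩
    · simp [Function.update_apply, hS.mem]
    · simpa [Function.update_apply, show ∀ j, ¬ (4 * i + 1 = 4 * j) by omega] using hS.out i
    · simpa [Function.update_apply, show ∀ j, ¬ (4 * i + 2 = 4 * j) by omega] using hS.free i
    · simpa [Function.update_apply, show ∀ j, ¬ (3 = 4 * j) by omega] using hS.len
  | write v s =>
    refine ⟨1 + 1, by omega, _, RAMExec.seq (RAMExec.store _ _ _) (RAMExec.store _ _ _), ?_⟩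
    simp only [RAMExpr.eval_quad, hS.eval, RAMExpr.eval, hS.len]
    refine ⟨fun i => ?_, fun i => ?_, fun i => ?_, ?_, hS.output⟩
    · simpa [Function.update_apply, show ∀ j, ¬ (4 * i = 4 * j + 1) by omega,
        show ¬ (4 * i = 3) by omega] using hS.mem i
    · have hi := hS.out i
      simp only [Function.update_apply, show ¬ (4 * i + 1 = 3) by omega, if_false,
        Nat.add_right_cancel_iff, Nat.mul_right_inj (show 4 ≠ 0 by decide), hi]
      split_ifs with hc
      · subst hc; simp
      · rcases lt_or_gt_of_ne hc with hc | hc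
        · simp [List.getD_eq_getElem?_getD, List.getElem?_append_left hc]
        · rw [List.getD_eq_default _ _ hc.le, List.getD_eq_default]
          simp; omega
    · simpa [Function.update_apply, show ∀ j, ¬ (4 * i + 2 = 4 * j + 1) by omega,
        show ¬ (4 * i + 2 = 3) by omega] using hS.free i
    · simp [Function.update_of_ne (show 3 ≠ 4 * s.output.length + 1 by omega), hS.len]
  | seq _ _ ih₁ ih₂ =>
    obtain ⟨t₁, ht₁, S₁, h₁, hS₁⟩ := ih₁ hS
    obtain ⟨t₂, ht₂, S₂, h₂, hS₂⟩ := ih₂ hS₁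
    exact ⟨_, by omega, S₂, RAMExec.seq h₁ h₂, hS₂⟩
  | iteTrue hc _ ih =>
    obtain ⟨t₁, ht₁, S₁, h₁, hS₁⟩ := ih hS
    exact ⟨_, by omega, S₁, RAMExec.iteTrue (by rwa [hS.eval]) h₁, hS₁⟩
  | iteFalse hc _ ih =>
    obtain ⟨t₁, ht₁, S₁, h₁, hS₁⟩ := ih hS
    exact ⟨_, by omega, S₁, RAMExec.iteFalse (by rwa [hS.eval]) h₁, hS₁⟩
  | whileTrue hc _ _ ih₁ ih₂ =>
    obtain ⟨t₁, ht₁, S₁, h₁, hS₁⟩ := ih₁ hS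
    obtain ⟨t₂, ht₂, S₂, h₂, hS₂⟩ := ih₂ hS₁
    exact ⟨_, by omega, S₂, RAMExec.whileTrue (by rwa [hS.eval]) h₁ h₂, hS₂⟩
  | whileFalse hc =>
    exact ⟨1, by omega, S, RAMExec.whileFalse (by rwa [hS.eval]), hS⟩

/-- The actual input `inp'` is never read, and no step becomes slower. Cells past the stored word
are `0`, as are reads outside of an input. -/
theorem ConsumerSim.exec {inp : List ℕ} {p : RAMProg} {s s' : RAMState} {t : ℕ}
    (h : RAMExec inp p s t s') {S : RAMState} (hS : ConsumerSim inp s S) (inp' : List ℕ) :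
    ∃ S', RAMExec inp' p.consumer S t S' ∧ ConsumerSim inp s' S' := by
  induction h generalizing S with
  | store a v s =>
    refine ⟨_, RAMExec.store _ _ _, ?_⟩
    simp only [RAMExpr.eval_quad, hS.eval, RAMExpr.eval]
    refine ⟨fun i => ?_, fun i => ?_, ?_, hS.output⟩
    · simp [Function.update_apply, hS.mem]
    · rw [← hS.data i]; exact Function.update_of_ne (by omega) _ _
    · simpa [Function.update_apply, show ∀ j, ¬ (3 = 4 * j + 2) by omega] using hS.len
  | write v s =>
    refine ⟨_, RAMExec.write _ _, hS.mem, hS.data, hS.len, ?_⟩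
    simp only [hS.eval, hS.output]
  | seq _ _ ih₁ ih₂ =>
    obtain ⟨S₁, h₁, hS₁⟩ := ih₁ hS
    obtain ⟨S₂, h₂, hS₂⟩ := ih₂ hS₁
    exact ⟨S₂, RAMExec.seq h₁ h₂, hS₂⟩
  | iteTrue hc _ ih =>
    obtain ⟨S₁, h₁, hS₁⟩ := ih hS
    exact ⟨S₁, RAMExec.iteTrue (by rwa [hS.eval]) h₁, hS₁⟩
  | iteFalse hc _ ih =>
    obtain ⟨S₁, h₁, hS₁⟩ := ih hS
    exact ⟨S₁, RAMExec.iteFalse (by rwa [hS.eval]) h₁, hS₁⟩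
  | whileTrue hc _ _ ih₁ ih₂ =>
    obtain ⟨S₁, h₁, hS₁⟩ := ih₁ hS
    obtain ⟨S₂, h₂, hS₂⟩ := ih₂ hS₁
    exact ⟨S₂, RAMExec.whileTrue (by rwa [hS.eval]) h₁ h₂, hS₂⟩
  | whileFalse hc =>
    exact ⟨S, RAMExec.whileFalse (by rwa [hS.eval]), hS⟩

/-! ### Growth of the values -/

/-- The size of an expression; constants count with their value. -/
def RAMExpr.size : RAMExpr → ℕ
  | const a => a
  | mem _ => 0
  | inputLen => 0
  | input _ => 0
  | add e₁ e₂ => e₁.size + e₂.size + 1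
  | sub e₁ _ => e₁.size
  | half e => e.size

/-- The total size of the values in a program. -/
def RAMProg.size : RAMProg → ℕ
  | store _ v => v.size
  | write v => v.size
  | seq p q => p.size + q.size
  | ite _ p q => p.size + q.size
  | .while _ p => p.size

/-- Only additions enlarge values, each at most doubling the larger operand; a constant `a` is below
`2 ^ a`. -/
theorem RAMExpr.eval_le {inp : List ℕ} {m : ℕ → ℕ} {B : ℕ} (hB : 1 ≤ B)
    (hinp : ∀ a ∈ inp, a ≤ B) (hlen : inp.length ≤ B) (hm : ∀ i, m i ≤ B) (e : RAMExpr) :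
    e.eval inp m ≤ 2 ^ e.size * B := by
  induction e with
  | const a => exact (Nat.lt_two_pow_self (n := a)).le.trans (Nat.le_mul_of_pos_right _ hB)
  | mem e _ => simpa [eval, size] using hm _
  | inputLen => simpa [eval, size] using hlen
  | input e _ =>
    simp only [eval, size, pow_zero, one_mul]
    generalize e.eval inp m = i
    rcases lt_or_ge i inp.length with h | h
    · rw [List.getD_eq_getElem _ _ h]; exact hinp _ (List.getElem_mem h)
    · rw [List.getD_eq_default _ _ h]; omega
  | add e₁ e₂ h₁ h₂ =>
    have h3 : 2 ^ e₁.size ≤ 2 ^ (e₁.size + e₂.size) := Nat.pow_le_pow_right (by omega) (by omega)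
    have h4 : 2 ^ e₂.size ≤ 2 ^ (e₁.size + e₂.size) := Nat.pow_le_pow_right (by omega) (by omega)
    have := Nat.mul_le_mul_right B h3
    have := Nat.mul_le_mul_right B h4
    simp only [eval, size]
    calc _ ≤ 2 ^ (e₁.size + e₂.size) * B + 2 ^ (e₁.size + e₂.size) * B := by omega
      _ = _ := by ring
  | sub e₁ e₂ h₁ h₂ => simp only [eval, size]; omega
  | half e h => simp only [eval, size]; omega

/-- All values of the state are at most `B`. -/
def RAMState.Bounded (s : RAMState) (B : ℕ) : Prop :=
  (∀ i, s.mem i ≤ B) ∧ ∀ a ∈ s.output, a ≤ B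

/-- Each step multiplies the largest value by at most `2 ^ S`, so bit lengths grow linearly with
time. `S` is any upper bound for the size, so that the same `S` serves all subprograms. -/
theorem RAMExec.bounded {inp : List ℕ} {p : RAMProg} {s s' : RAMState} {t S : ℕ}
    (h : RAMExec inp p s t s') (hS : p.size ≤ S) {B : ℕ} (hB : 1 ≤ B)
    (hinp : ∀ a ∈ inp, a ≤ B) (hlen : inp.length ≤ B) (hs : s.Bounded B) :
    s'.Bounded (2 ^ (S * t) * B) ∧ s'.output.length ≤ s.output.length + t := by
  have key : ∀ {v : RAMExpr} {s : RAMState} {B : ℕ}, v.size ≤ S → 1 ≤ B →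
      (∀ a ∈ inp, a ≤ B) → inp.length ≤ B → s.Bounded B →
      v.eval inp s.mem ≤ 2 ^ (S * 1) * B := by
    intro v s B hv hB hinp hlen hs
    refine (RAMExpr.eval_le hB hinp hlen hs.1 v).trans (Nat.mul_le_mul_right _ ?_)
    exact Nat.pow_le_pow_right (by omega) (by omega)
  have up : ∀ {n B : ℕ}, B ≤ 2 ^ n * B := fun {n B} => Nat.le_mul_of_pos_left _ (by positivity)
  have mono : ∀ {n n' B : ℕ}, n ≤ n' → 2 ^ (S * n) * B ≤ 2 ^ (S * n') * B := fun h =>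
    Nat.mul_le_mul_right _ (Nat.pow_le_pow_right (by omega) (Nat.mul_le_mul_left _ h))
  have weaken : ∀ {s : RAMState} {B B' : ℕ}, s.Bounded B → B ≤ B' → s.Bounded B' :=
    fun h hB => ⟨fun i => (h.1 i).trans hB, fun a ha => (h.2 a ha).trans hB⟩
  have comp : ∀ {t t' B : ℕ}, 2 ^ (S * t') * (2 ^ (S * t) * B) = 2 ^ (S * (t + t')) * B := by
    intros; ring
  induction h generalizing B with
  | store a v s =>
    refine ⟨⟨fun i => ?_, fun a ha => (hs.2 a ha).trans up⟩, by simp⟩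
    simp only [Function.update_apply]
    split_ifs
    · exact key hS hB hinp hlen hs
    · exact (hs.1 i).trans up
  | write v s =>
    refine ⟨⟨fun i => (hs.1 i).trans up, fun a ha => ?_⟩, by simp⟩
    rcases List.mem_append.1 ha with ha | ha
    · exact (hs.2 a ha).trans up
    · rw [List.mem_singleton] at ha; subst ha; exact key hS hB hinp hlen hs
  | seq _ _ ih₁ ih₂ =>
    simp only [RAMProg.size] at hS
    obtain ⟨b₁, l₁⟩ := ih₁ (by omega) hB hinp hlen hs
    obtain ⟨b₂, l₂⟩ := ih₂ (by omega) (hB.trans up) (fun a ha => (hinp a ha).trans up)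
      (hlen.trans up) b₁
    rw [comp] at b₂
    exact ⟨b₂, by omega⟩
  | iteTrue _ _ ih =>
    simp only [RAMProg.size] at hS
    obtain ⟨b₁, l₁⟩ := ih (by omega) hB hinp hlen hs
    exact ⟨weaken b₁ (mono (by omega)), by omega⟩
  | iteFalse _ _ ih =>
    simp only [RAMProg.size] at hS
    obtain ⟨b₁, l₁⟩ := ih (by omega) hB hinp hlen hs
    exact ⟨weaken b₁ (mono (by omega)), by omega⟩
  | whileTrue _ _ _ ih₁ ih₂ =>
    obtain ⟨b₁, l₁⟩ := ih₁ hS hB hinp hlen hs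
    obtain ⟨b₂, l₂⟩ := ih₂ hS (hB.trans up) (fun a ha => (hinp a ha).trans up)
      (hlen.trans up) b₁
    rw [comp] at b₂
    exact ⟨weaken b₂ (mono (by omega)), by omega⟩
  | whileFalse _ => exact ⟨weaken hs up, by simp⟩

theorem length_le_wordSize (w : List ℕ) : w.length ≤ wordSize w := by
  induction w with
  | nil => simp
  | cons a w ih => simp only [wordSize, List.map_cons, List.sum_cons, List.length_cons] at *; omega

theorem size_le_wordSize {w : List ℕ} {a : ℕ} (h : a ∈ w) : a.size ≤ wordSize w := by
  have := List.single_le_sum (l := w.map fun a => a.size + 1) (by simp) (a.size + 1)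
    (List.mem_map.2 ⟨a, h, rfl⟩)
  simp only [wordSize]; omega

theorem wordSize_le {w : List ℕ} {n : ℕ} (h : ∀ a ∈ w, a ≤ 2 ^ n) :
    wordSize w ≤ w.length * (n + 2) := by
  have := List.sum_le_card_nsmul (w.map fun a => a.size + 1) (n + 2) (by
    simp only [List.mem_map]
    rintro _ ⟨a, ha, rfl⟩
    have : a.size ≤ n + 1 := Nat.size_le.2 ((h a ha).trans_lt (by rw [pow_succ]; have := Nat.two_pow_pos n; omega))
    omega)
  simpa [wordSize] using this

/-- There are at most `t` output items, each of bit length linear in `t` and the input size. This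
bounds the instance handed to a second reduction. -/
theorem RAMExec.wordSize_output_le {inp : List ℕ} {p : RAMProg} {s : RAMState} {t : ℕ}
    (h : RAMExec inp p RAMState.init t s) :
    wordSize s.output ≤ t * (p.size * t + wordSize inp + 2) := by
  obtain ⟨hb, hl⟩ := h.bounded (S := p.size) le_rfl (B := 2 ^ wordSize inp) Nat.one_le_two_pow
    (fun a ha => ((Nat.lt_size_self a).le.trans
      (Nat.pow_le_pow_right (by omega) (size_le_wordSize ha))))
    ((length_le_wordSize inp).trans Nat.lt_two_pow_self.le)
    ⟨fun i => by simp [RAMState.init], by simp [RAMState.init]⟩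
  rw [← pow_add] at hb
  refine (wordSize_le hb.2).trans (Nat.mul_le_mul_right _ ?_)
  simpa [RAMState.init] using hl

/-! ### Computable bounds and transitivity of reductions -/

theorem Computable.sum_range {f : ℕ → ℕ} (hf : Computable f) :
    Computable fun n => ∑ i ∈ Finset.range n, f i := by
  have := Computable.nat_rec (f := fun n : ℕ => n) (g := fun _ => 0)
    (h := fun _ p => p.2 + f p.1) Computable.id (Computable.const 0)
    (Primrec.nat_add.to_comp.comp (Computable.snd.comp Computable.snd)
      (hf.comp (Computable.fst.comp Computable.snd)))
  refine this.of_eq fun n => ?_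
  induction n with
  | zero => rfl
  | succ n ih => rw [Finset.sum_range_succ, ← ih]

theorem Computable.nat_add {f g : ℕ → ℕ} (hf : Computable f) (hg : Computable g) :
    Computable fun n => f n + g n := Primrec.nat_add.to_comp.comp hf hg

theorem Computable.nat_mul {f g : ℕ → ℕ} (hf : Computable f) (hg : Computable g) :
    Computable fun n => f n * g n := Primrec.nat_mul.to_comp.comp hf hg

theorem Computable.nat_pow_const {f : ℕ → ℕ} (hf : Computable f) (c : ℕ) :
    Computable fun n => f n ^ c := by
  induction c with
  | zero => simpa using Computable.const 1
  | succ c ih => simpa [pow_succ] using ih.nat_mul hf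

theorem FPTReducible.trans {P Q R : ParamProblem} (hPQ : FPTReducible P Q)
    (hQR : FPTReducible Q R) : FPTReducible P R := by
  obtain ⟨p₁, f₁, g₁, c₁, hf₁, hg₁, h₁⟩ := hPQ
  obtain ⟨p₂, f₂, g₂, c₂, hf₂, hg₂, h₂⟩ := hQR
  -- The intermediate parameter is only known to be at most `g₁ k`, and `f₂`, `g₂` need not be
  -- monotone; summing over all candidates gives computable bounds.
  let F : ℕ → ℕ := fun k => ∑ i ∈ Finset.range (g₁ k + 1), f₂ i
  let G : ℕ → ℕ := fun k => ∑ i ∈ Finset.range (g₁ k + 1), g₂ i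
  -- One quantity dominating all contributions of the first reduction that do not depend on `w`.
  let φ : ℕ → ℕ := fun k => f₁ k + k + (p₁.size + 3)
  have hg₁' : Computable fun k => g₁ k + 1 := hg₁.nat_add (Computable.const 1)
  have hF : Computable F := hf₂.sum_range.comp hg₁'
  have hG : Computable G := hg₂.sum_range.comp hg₁'
  have hφ : Computable φ := (hf₁.nat_add Computable.id).nat_add (Computable.const _)
  refine ⟨.seq p₁.producer p₂.consumer, fun k => 2 * φ k + F k * (φ k ^ 5) ^ c₂, G,
    (c₁ + 1) * (2 * c₂ + 1), ((Computable.const 2).nat_mul hφ).nat_add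
      (hF.nat_mul ((hφ.nat_pow_const 5).nat_pow_const c₂)), hG, fun w k => ?_⟩
  obtain ⟨w₁, k₁, t₁, m₁, e₁, ht₁, hk₁, hiff₁⟩ := h₁ w k
  obtain ⟨w₂, k₂, t₂, m₂, e₂, ht₂, hk₂, hiff₂⟩ := h₂ w₁ k₁
  obtain ⟨t', ht', S₁, E₁, hS₁⟩ := ProducerSim.exec e₁ (S := RAMState.init)
    ⟨fun _ => rfl, fun _ => by simp [RAMState.init], fun _ => rfl, rfl, rfl⟩
  obtain ⟨S₂, E₂, hS₂⟩ := ConsumerSim.exec e₂ (S := S₁)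
    ⟨hS₁.free, hS₁.out, hS₁.len, hS₁.output⟩ (k :: w)
  have hmono : ∀ f : ℕ → ℕ, f k₁ ≤ ∑ i ∈ Finset.range (g₁ k + 1), f i := fun f =>
    Finset.single_le_sum (f := f) (fun _ _ => Nat.zero_le _) (Finset.mem_range.2 (by omega))
  refine ⟨w₂, k₂, t' + t₂, S₂.mem, ?_, ?_, hk₂.trans (hmono g₂), hiff₁.trans hiff₂⟩
  · have := hS₂.output
    simp only at this
    rw [← this]
    exact RAMExec.seq E₁ E₂
  · set N := wordSize w + 1 with hN
    -- The exponent `c₁ + 1` makes `X` dominate both `N ^ c₁` and `N`, even for `c₁ = 0`.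
    set X := N ^ (c₁ + 1) with hX
    have hφ3 : 3 ≤ φ k := by simp only [φ]; omega
    have hN1 : 1 ≤ N := by omega
    have hX1 : 1 ≤ X := Nat.one_le_pow _ _ hN1
    have hNX : N ≤ X := Nat.le_self_pow (by omega) _
    have ht₁X : t₁ ≤ φ k * X := by
      refine ht₁.trans (Nat.mul_le_mul ?_ (Nat.pow_le_pow_right hN1 (by omega)))
      simp only [φ]; omega
    have hw₁ : wordSize w₁ + 1 ≤ φ k ^ 5 * X ^ 2 := by
      have hws : wordSize (k₁ :: w₁) ≤ _ := e₁.wordSize_output_le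
      have h0 : wordSize w₁ ≤ wordSize (k₁ :: w₁) := by simp [wordSize]
      have hin : wordSize (k :: w) + 2 ≤ φ k * X + X := by
        have hk : k.size ≤ k := Nat.size_le.2 Nat.lt_two_pow_self
        have : wordSize (k :: w) = k.size + 1 + wordSize w := by simp [wordSize]
        have : k + 3 ≤ φ k := by simp only [φ]; omega
        nlinarith
      have hst : p₁.size * t₁ ≤ φ k * (φ k * X) := by
        refine Nat.mul_le_mul ?_ ht₁X
        simp only [φ]; omega
      have hinner : p₁.size * t₁ + wordSize (k :: w) + 2 ≤ φ k ^ 3 * X := by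
        have : φ k * (φ k * X) + (φ k * X + X) ≤ φ k ^ 3 * X := by
          have h3 : φ k * φ k + φ k + 1 ≤ φ k ^ 3 := by nlinarith [Nat.mul_le_mul hφ3 hφ3]
          have := Nat.mul_le_mul_right X h3
          nlinarith
        omega
      have hprod := Nat.mul_le_mul ht₁X hinner
      have h4 : φ k * X * (φ k ^ 3 * X) + 1 ≤ φ k ^ 5 * X ^ 2 := by
        have e : φ k * X * (φ k ^ 3 * X) = φ k ^ 4 * X ^ 2 := by ring
        have e' : φ k ^ 5 * X ^ 2 = φ k * (φ k ^ 4 * X ^ 2) := by ring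
        have : 1 ≤ φ k ^ 4 * X ^ 2 := Nat.mul_pos (by positivity) (by positivity)
        rw [e, e']; nlinarith
      have := hws.trans hprod
      omega
    have ht₂' : t₂ ≤ F k * (φ k ^ 5) ^ c₂ * X ^ (2 * c₂) := by
      calc t₂ ≤ f₂ k₁ * (wordSize w₁ + 1) ^ c₂ := ht₂
        _ ≤ F k * (φ k ^ 5 * X ^ 2) ^ c₂ :=
          Nat.mul_le_mul (hmono f₂) (Nat.pow_le_pow_left hw₁ _)
        _ = _ := by rw [mul_pow, ← pow_mul X, mul_assoc]
    have hX2 : X ^ (2 * c₂) ≤ X ^ (2 * c₂ + 1) := Nat.pow_le_pow_right hX1 (by omega)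
    have hX3 : X ≤ X ^ (2 * c₂ + 1) := Nat.le_self_pow (by omega) _
    calc t' + t₂ ≤ 2 * (φ k * X) + F k * (φ k ^ 5) ^ c₂ * X ^ (2 * c₂) := by omega
      _ ≤ 2 * (φ k * X ^ (2 * c₂ + 1)) + F k * (φ k ^ 5) ^ c₂ * X ^ (2 * c₂ + 1) := by gcongr
      _ = _ := by rw [pow_mul N, ← hX]; ring

/-! ## The grid network -/

/-- A type whose elements are indexed by the pairs of numbers below `W`. -/
structure Grid (V : Type) (W : ℕ) where
  row : V → ℕ
  col : V → ℕ
  vtx : ℕ → ℕ → V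
  row_lt : ∀ u, row u < W
  col_lt : ∀ u, col u < W
  row_vtx : ∀ a b, a < W → b < W → row (vtx a b) = a
  col_vtx : ∀ a b, a < W → b < W → col (vtx a b) = b
  vtx_row_col : ∀ u, vtx (row u) (col u) = u

/-- The arcs of weight one of the grid network: from the root `(1, 2)` to `(a, 0)`, from the root
`(2, 1)` to `(0, b)`, and from a compatible pair `(a, b)` to the leaf `(3 + T a, 3 + T b)`. -/
def gridOne (K : ℕ) (T : ℕ → ℕ) (R : ℕ → ℕ → Prop) (a b a' b' : ℕ) : Prop :=
  (a = 1 ∧ b = 2 ∧ 3 + K ≤ a' ∧ b' = 0) ∨ (a = 2 ∧ b = 1 ∧ a' = 0 ∧ 3 + K ≤ b') ∨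
    (3 + K ≤ a ∧ 3 + K ≤ b ∧ a' = 3 + T a ∧ b' = 3 + T b ∧ a' < 3 + K ∧ b' < 3 + K ∧ R a b)

/-- The arcs of weight zero of the grid network: from `(a, 0)` and `(0, b)` to `(a, b)`, and from
`(0, 0)` to the two roots. -/
def gridZero (K a b a' b' : ℕ) : Prop :=
  (3 + K ≤ a ∧ b = 0 ∧ a' = a ∧ 3 + K ≤ b') ∨ (a = 0 ∧ 3 + K ≤ b ∧ 3 + K ≤ a' ∧ b' = b) ∨
    (a = 0 ∧ b = 0 ∧ (a' = 1 ∧ b' = 2 ∨ a' = 2 ∧ b' = 1))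

/-- The terminals of the grid network. -/
def gridTerm (K a b : ℕ) : Prop :=
  (a = 0 ∧ b = 0) ∨ (a = 1 ∧ b = 2) ∨ (a = 2 ∧ b = 1) ∨
    (3 ≤ a ∧ a < 3 + K ∧ 3 ≤ b ∧ b < 3 + K)

/-- The pattern of the grid network. -/
def gridPat (K a b a' b' : ℕ) : Prop :=
  ((a = 1 ∧ b = 2 ∨ a = 2 ∧ b = 1) ∧ 3 ≤ a' ∧ a' < 3 + K ∧ 3 ≤ b' ∧ b' < 3 + K) ∨
    (a = 0 ∧ b = 0 ∧ (a' = 1 ∧ b' = 2 ∨ a' = 2 ∧ b' = 1))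

/-- The roots sit at `(1, 2)` and `(2, 1)`, so transposing the grid exchanges them, and statements
on the second root follow from those on the first. -/
theorem gridOne_swap {K : ℕ} {T : ℕ → ℕ} {R : ℕ → ℕ → Prop} {a b a' b' : ℕ} :
    gridOne K T (flip R) b a b' a' ↔ gridOne K T R a b a' b' := by
  simp only [gridOne, flip]; tauto

theorem gridZero_swap {K a b a' b' : ℕ} : gridZero K b a b' a' ↔ gridZero K a b a' b' := by
  simp only [gridZero]; tauto

theorem not_gridZero_of_gridOne {K : ℕ} {T : ℕ → ℕ} {R : ℕ → ℕ → Prop} {a b a' b' : ℕ}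
    (h : gridOne K T R a b a' b') : ¬ gridZero K a b a' b' := by
  rcases h with h | h | h <;> rintro (h' | h' | h') <;> omega

theorem gridPat_term {K a b a' b' : ℕ} (h : gridPat K a b a' b') :
    gridTerm K a b ∧ gridTerm K a' b' := by
  rcases h with ⟨h | h, h'⟩ | ⟨h, h', h'' | h''⟩ <;> simp only [gridTerm] <;> omega

namespace Grid

variable {V : Type} {W : ℕ}

/-- The grid with rows and columns exchanged. -/
def swap (g : Grid V W) : Grid V W where
  row := g.col
  col := g.row
  vtx a b := g.vtx b a
  row_lt := g.col_lt
  col_lt := g.row_lt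
  row_vtx a b ha hb := g.col_vtx b a hb ha
  col_vtx a b ha hb := g.row_vtx b a hb ha
  vtx_row_col := g.vtx_row_col

/-- A path from the root `(1, 2)` to a leaf uses an arc to some `(a, 0)` and the arc to the leaf
from a compatible pair `(a, b)`. -/
theorem exists_of_reach (g : Grid V W) {K : ℕ} {T : ℕ → ℕ} {R : ℕ → ℕ → Prop}
    {N : Set (V × V)}
    (hN : ∀ u v, (u, v) ∈ N → gridOne K T R (g.row u) (g.col u) (g.row v) (g.col v) ∨
      gridZero K (g.row u) (g.col u) (g.row v) (g.col v))
    {r l : V} (hr : g.row r = 1 ∧ g.col r = 2) (hl : 3 ≤ g.row l ∧ g.row l < 3 + K)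
    (h : Relation.ReflTransGen (fun u v => (u, v) ∈ N) r l) :
    ∃ y z, (r, y) ∈ N ∧ (z, l) ∈ N ∧ g.row y = g.row z ∧ g.col y = 0 ∧ 3 + K ≤ g.row z ∧
      3 + K ≤ g.col z ∧ R (g.row z) (g.col z) ∧ g.row l = 3 + T (g.row z) ∧
      g.col l = 3 + T (g.col z) := by
  -- Moving from `(a, 0)` to `(a, b)` preserves the row, which thus remembers the arc bought at the
  -- root. Leaves have no outgoing arcs, so a path ends at the first leaf it enters.
  have key : ∀ v, Relation.ReflTransGen (fun u v => (u, v) ∈ N) r v →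
      v = r ∨ (3 + K ≤ g.row v ∧ g.col v = 0 ∧ (r, v) ∈ N) ∨
      (3 + K ≤ g.row v ∧ 3 + K ≤ g.col v ∧
        ∃ y, (r, y) ∈ N ∧ g.row y = g.row v ∧ g.col y = 0) ∨
      (3 ≤ g.row v ∧ g.row v < 3 + K ∧ 3 ≤ g.col v ∧ g.col v < 3 + K ∧
        ∃ y z, (r, y) ∈ N ∧ (z, v) ∈ N ∧ g.row y = g.row z ∧ g.col y = 0 ∧ 3 + K ≤ g.row z ∧
          3 + K ≤ g.col z ∧ R (g.row z) (g.col z) ∧ g.row v = 3 + T (g.row z) ∧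
          g.col v = 3 + T (g.col z)) := by
    intro v hv
    induction hv with
    | refl => exact Or.inl rfl
    | @tail u v _ huv ih =>
      have ha := hN u v huv
      rcases ih with rfl | ⟨h1, h2, h3⟩ | ⟨h1, h2, y, h3, h4, h5⟩ | ⟨h1, h2, h3, h4, _⟩
      · rcases ha with (ha | ha | ha) | (ha | ha | ha) <;> try omega
        exact Or.inr (Or.inl ⟨ha.2.2.1, ha.2.2.2, huv⟩)
      · rcases ha with (ha | ha | ha) | (ha | ha | ha) <;> try omega
        exact Or.inr (Or.inr (Or.inl ⟨by omega, ha.2.2.2, u, h3, ha.2.2.1.symm, h2⟩))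
      · rcases ha with (ha | ha | ha) | (ha | ha | ha) <;> try omega
        obtain ⟨_, _, e1, e2, l1, l2, hR⟩ := ha
        exact Or.inr (Or.inr (Or.inr ⟨by omega, l1, by omega, l2, y, u, h3, huv, h4, h5, h1, h2,
          hR, e1, e2⟩))
      · rcases ha with (ha | ha | ha) | (ha | ha | ha) <;> omega
  rcases key l h with rfl | h | h | ⟨_, _, _, _, h⟩
  · omega
  · omega
  · omega
  · exact h

/-- The groups of arcs of weight one: one for each arc that any solution has to pay for. -/
def slot (g : Grid V W) (T : ℕ → ℕ) (e : V × V) : ℕ ⊕ ℕ ⊕ ℕ × ℕ :=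
  if g.row e.1 = 1 then .inl (T (g.row e.2))
  else if g.row e.1 = 2 then .inr (.inl (T (g.col e.2)))
  else .inr (.inr (T (g.row e.1), T (g.col e.1)))

/-- All groups of arcs of weight one. -/
def slots (K : ℕ) : Finset (ℕ ⊕ ℕ ⊕ ℕ × ℕ) :=
  (Finset.range K).disjSum ((Finset.range K).disjSum (Finset.range K ×ˢ Finset.range K))

theorem card_slots (K : ℕ) : (slots K).card = 2 * K + K * K := by
  simp [slots]; ring

-- A counting argument: each of the `2 * K + K * K` slots contains an arc of the solution, so the
-- budget leaves one arc per slot. The arc into the leaf `(i, j)` is then common to the paths from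
-- both roots, and its tail is determined by the row bought by root 1 for `i` and the column bought
-- by root 2 for `j`.
open Classical in
theorem choice_of_cheap (g : Grid V W) {K : ℕ} (hK : 0 < K) (hW : 3 + K ≤ W) {T : ℕ → ℕ}
    {R : ℕ → ℕ → Prop} {N : Finset (V × V)}
    (hN : ∀ u v, (u, v) ∈ N → gridOne K T R (g.row u) (g.col u) (g.row v) (g.col v) ∨
      gridZero K (g.row u) (g.col u) (g.row v) (g.col v))
    (hpath : ∀ s t, gridPat K (g.row s) (g.col s) (g.row t) (g.col t) →
      Relation.ReflTransGen (fun u v => (u, v) ∈ N) s t)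
    (hcost : (N.filter fun e => gridOne K T R (g.row e.1) (g.col e.1) (g.row e.2)
      (g.col e.2)).card ≤ 2 * K + K * K) :
    ∃ c d : ℕ → ℕ, ∀ i < K, ∀ j < K, c i < W ∧ d j < W ∧ 3 + K ≤ c i ∧ 3 + K ≤ d j ∧
      T (c i) = i ∧ T (d j) = j ∧ R (c i) (d j) := by
  set N₁ := N.filter fun e => gridOne K T R (g.row e.1) (g.col e.1) (g.row e.2) (g.col e.2)
    with hN₁
  have hr₁ := g.row_vtx 1 2 (by omega) (by omega)
  have hc₁ := g.col_vtx 1 2 (by omega) (by omega)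
  have hr₂ := g.row_vtx 2 1 (by omega) (by omega)
  have hc₂ := g.col_vtx 2 1 (by omega) (by omega)
  set r₁ := g.vtx 1 2
  set r₂ := g.vtx 2 1
  have left : ∀ i < K, ∀ j < K, ∃ y z, (r₁, y) ∈ N ∧ (z, g.vtx (3 + i) (3 + j)) ∈ N ∧
      g.row y = g.row z ∧ g.col y = 0 ∧ 3 + K ≤ g.row z ∧ 3 + K ≤ g.col z ∧
      R (g.row z) (g.col z) ∧ T (g.row z) = i ∧ T (g.col z) = j := by
    intro i hi j hj
    have hr := g.row_vtx (3 + i) (3 + j) (by omega) (by omega)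
    have hc := g.col_vtx (3 + i) (3 + j) (by omega) (by omega)
    obtain ⟨y, z, h1, h2, h3, h4, h5, h6, h7, h8, h9⟩ :=
      g.exists_of_reach (K := K) (N := (N : Set (V × V))) hN ⟨hr₁, hc₁⟩
        (by rw [hr]; omega)
        (hpath r₁ (g.vtx (3 + i) (3 + j)) (Or.inl ⟨by omega, by omega⟩))
    exact ⟨y, z, h1, h2, h3, h4, h5, h6, h7, by omega, by omega⟩
  have right : ∀ i < K, ∀ j < K, ∃ y z, (r₂, y) ∈ N ∧ (z, g.vtx (3 + i) (3 + j)) ∈ N ∧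
      g.col y = g.col z ∧ g.row y = 0 ∧ 3 + K ≤ g.row z ∧ 3 + K ≤ g.col z ∧
      R (g.row z) (g.col z) ∧ T (g.row z) = i ∧ T (g.col z) = j := by
    intro i hi j hj
    have hr := g.row_vtx (3 + i) (3 + j) (by omega) (by omega)
    have hc := g.col_vtx (3 + i) (3 + j) (by omega) (by omega)
    obtain ⟨y, z, h1, h2, h3, h4, h5, h6, h7, h8, h9⟩ :=
      g.swap.exists_of_reach (K := K) (T := T) (R := flip R) (N := (N : Set (V × V)))
        (fun u v h => (hN u v h).imp gridOne_swap.2 gridZero_swap.2) ⟨hc₂, hr₂⟩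
        (l := g.vtx (3 + i) (3 + j))
        (by simp only [swap, hc]; omega)
        (hpath r₂ (g.vtx (3 + i) (3 + j)) (Or.inl ⟨by omega, by omega⟩))
    simp only [swap, flip] at h3 h4 h5 h6 h7 h8 h9
    exact ⟨y, z, h1, h2, h3, h4, h6, h5, h7, by omega, by omega⟩
  have : Nonempty V := ⟨r₁⟩
  choose! y z hy hz hyz hy0 hza hzb hR hTa hTb using left
  choose! y' z' hy' hz' hyz' hy0' hza' hzb' hR' hTa' hTb' using right
  have my : ∀ i < K, ∀ j < K, (r₁, y i j) ∈ N₁ := fun i hi j hj =>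
    Finset.mem_filter.2 ⟨hy i hi j hj, Or.inl ⟨hr₁, hc₁,
      (hza i hi j hj).trans (hyz i hi j hj).ge, hy0 i hi j hj⟩⟩
  have my' : ∀ i < K, ∀ j < K, (r₂, y' i j) ∈ N₁ := fun i hi j hj =>
    Finset.mem_filter.2 ⟨hy' i hi j hj, Or.inr (Or.inl ⟨hr₂, hc₂,
      hy0' i hi j hj, (hzb' i hi j hj).trans (hyz' i hi j hj).ge⟩)⟩
  have leafArc : ∀ z i j, i < K → j < K → (z, g.vtx (3 + i) (3 + j)) ∈ N → 3 + K ≤ g.row z →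
      3 + K ≤ g.col z → R (g.row z) (g.col z) → T (g.row z) = i → T (g.col z) = j →
      (z, g.vtx (3 + i) (3 + j)) ∈ N₁ := by
    intro z i j hi hj h h1 h2 h3 h4 h5
    refine Finset.mem_filter.2 ⟨h, Or.inr (Or.inr ⟨h1, h2, ?_⟩)⟩
    have hr := g.row_vtx (3 + i) (3 + j) (by omega) (by omega)
    have hc := g.col_vtx (3 + i) (3 + j) (by omega) (by omega)
    simp only [hr, hc, h4, h5]
    exact ⟨trivial, trivial, by omega, by omega, h3⟩
  have mz := fun i hi j hj => leafArc _ i j hi hj (hz i hi j hj) (hza i hi j hj) (hzb i hi j hj)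
    (hR i hi j hj) (hTa i hi j hj) (hTb i hi j hj)
  have mz' := fun i hi j hj => leafArc _ i j hi hj (hz' i hi j hj) (hza' i hi j hj)
    (hzb' i hi j hj) (hR' i hi j hj) (hTa' i hi j hj) (hTb' i hi j hj)
  have sy : ∀ i < K, ∀ j < K, g.slot T (r₁, y i j) = .inl i := fun i hi j hj => by
    simp [slot, hr₁, hyz i hi j hj, hTa i hi j hj]
  have sy' : ∀ i < K, ∀ j < K, g.slot T (r₂, y' i j) = .inr (.inl j) := fun i hi j hj => by
    simp [slot, hr₂, hyz' i hi j hj, hTb' i hi j hj]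
  have sz : ∀ i < K, ∀ j < K, g.slot T (z i j, g.vtx (3 + i) (3 + j)) = .inr (.inr (i, j)) :=
    fun i hi j hj => by
      have := hza i hi j hj
      simp [slot, hTa i hi j hj, hTb i hi j hj, show g.row (z i j) ≠ 1 by omega,
        show g.row (z i j) ≠ 2 by omega]
  have sz' : ∀ i < K, ∀ j < K, g.slot T (z' i j, g.vtx (3 + i) (3 + j)) = .inr (.inr (i, j)) :=
    fun i hi j hj => by
      have := hza' i hi j hj
      simp [slot, hTa' i hi j hj, hTb' i hi j hj, show g.row (z' i j) ≠ 1 by omega,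
        show g.row (z' i j) ≠ 2 by omega]
  -- Any leaf in row `i` (or column `j`) witnesses that the slot of a root is occupied; index `0` is
  -- available since `K` is positive.
  have hsub : slots K ⊆ N₁.image (g.slot T) := by
    rintro (i | j | ⟨i, j⟩) hs
    · have hi : i < K := by simpa [slots] using hs
      exact Finset.mem_image.2 ⟨_, my i hi 0 hK, sy i hi 0 hK⟩
    · have hj : j < K := by simpa [slots] using hs
      exact Finset.mem_image.2 ⟨_, my' 0 hK j hj, sy' 0 hK j hj⟩
    · have hij : i < K ∧ j < K := by simpa [slots] using hs
      exact Finset.mem_image.2 ⟨_, mz i hij.1 j hij.2, sz i hij.1 j hij.2⟩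
  -- All slots are hit by at most as many arcs as there are slots, so no slot is hit twice.
  have hinj : Set.InjOn (g.slot T) N₁ := by
    rw [← Finset.card_image_iff]
    refine le_antisymm Finset.card_image_le ?_
    have := Finset.card_le_card hsub
    rw [card_slots] at this
    omega
  refine ⟨fun i => g.row (y i 0), fun j => g.col (y' 0 j), fun i hi j hj => ?_⟩
  have e1 : y i 0 = y i j := congrArg Prod.snd
    (hinj (my i hi 0 hK) (my i hi j hj) ((sy i hi 0 hK).trans (sy i hi j hj).symm))
  have e2 : y' 0 j = y' i j := congrArg Prod.snd
    (hinj (my' 0 hK j hj) (my' i hi j hj) ((sy' 0 hK j hj).trans (sy' i hi j hj).symm))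
  -- The decisive coincidence: both roots enter the leaf through the same arc.
  have e3 : z i j = z' i j := congrArg Prod.fst
    (hinj (mz i hi j hj) (mz' i hi j hj) ((sz i hi j hj).trans (sz' i hi j hj).symm))
  simp only [e1, e2, hyz i hi j hj, hyz' i hi j hj, ← e3]
  exact ⟨g.row_lt _, g.col_lt _, hza i hi j hj, hzb i hi j hj, hTa i hi j hj, hTb i hi j hj,
    hR i hi j hj⟩

-- All arcs of weight zero are taken for free, together with one arc of weight one per slot.
open Classical in
theorem cheap_of_choice [Fintype V] (g : Grid V W) {K : ℕ} (hW : 3 + K ≤ W) {T : ℕ → ℕ}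
    {R : ℕ → ℕ → Prop} {c d : ℕ → ℕ}
    (hcd : ∀ i < K, ∀ j < K, c i < W ∧ d j < W ∧ 3 + K ≤ c i ∧ 3 + K ≤ d j ∧
      T (c i) = i ∧ T (d j) = j ∧ R (c i) (d j)) :
    ∃ N : Finset (V × V),
      (∀ u v, (u, v) ∈ N → gridOne K T R (g.row u) (g.col u) (g.row v) (g.col v) ∨
        gridZero K (g.row u) (g.col u) (g.row v) (g.col v)) ∧
      (∀ s t, gridPat K (g.row s) (g.col s) (g.row t) (g.col t) →
        Relation.ReflTransGen (fun u v => (u, v) ∈ N) s t) ∧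
      (N.filter fun e => gridOne K T R (g.row e.1) (g.col e.1) (g.row e.2)
        (g.col e.2)).card ≤ 2 * K + K * K := by
  let Z : Finset (V × V) := Finset.univ.filter fun e =>
    gridZero K (g.row e.1) (g.col e.1) (g.row e.2) (g.col e.2)
  let ψ : ℕ ⊕ ℕ ⊕ ℕ × ℕ → V × V := fun
    | .inl i => (g.vtx 1 2, g.vtx (c i) 0)
    | .inr (.inl j) => (g.vtx 2 1, g.vtx 0 (d j))
    | .inr (.inr (i, j)) => (g.vtx (c i) (d j), g.vtx (3 + i) (3 + j))
  have hone : ∀ e ∈ (slots K).image ψ,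
      gridOne K T R (g.row e.1) (g.col e.1) (g.row e.2) (g.col e.2) := by
    intro e he
    obtain ⟨s, hs, rfl⟩ := Finset.mem_image.1 he
    rcases s with i | j | ⟨i, j⟩
    · have hi : i < K := by simpa [slots] using hs
      have h := hcd i hi i hi
      refine Or.inl ?_
      simp only [ψ]
      rw [g.row_vtx, g.col_vtx, g.row_vtx, g.col_vtx] <;> omega
    · have hj : j < K := by simpa [slots] using hs
      have h := hcd j hj j hj
      refine Or.inr (Or.inl ?_)
      simp only [ψ]
      rw [g.row_vtx, g.col_vtx, g.row_vtx, g.col_vtx] <;> omega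
    · have hij : i < K ∧ j < K := by simpa [slots] using hs
      obtain ⟨h1, h2, h3, h4, h5, h6, h7⟩ := hcd i hij.1 j hij.2
      refine Or.inr (Or.inr ?_)
      simp only [ψ]
      rw [g.row_vtx _ _ h1 h2, g.col_vtx _ _ h1 h2, g.row_vtx _ _ (by omega) (by omega),
        g.col_vtx _ _ (by omega) (by omega), h5, h6]
      exact ⟨h3, h4, rfl, rfl, by omega, by omega, h7⟩
  refine ⟨Z ∪ (slots K).image ψ, fun u v h => ?_, fun s t h => ?_, ?_⟩
  · rcases Finset.mem_union.1 h with h | h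
    · exact Or.inr (Finset.mem_filter.1 h).2
    · exact Or.inl (hone _ h)
  · have zero : ∀ u v, gridZero K (g.row u) (g.col u) (g.row v) (g.col v) →
        (u, v) ∈ Z ∪ (slots K).image ψ := fun u v h =>
      Finset.mem_union_left _ (Finset.mem_filter.2 ⟨Finset.mem_univ _, h⟩)
    have one : ∀ s ∈ slots K, ψ s ∈ Z ∪ (slots K).image ψ := fun s hs =>
      Finset.mem_union_right _ (Finset.mem_image_of_mem _ hs)
    rcases h with ⟨hs, h1, h2, h3, h4⟩ | h
    · obtain ⟨i, hi⟩ := Nat.exists_eq_add_of_le h1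
      obtain ⟨j, hj⟩ := Nat.exists_eq_add_of_le h3
      have hik : i < K := by omega
      have hjk : j < K := by omega
      obtain ⟨l1, l2, l3, l4, h5, h6, h7⟩ := hcd i hik j hjk
      have ht : t = g.vtx (3 + i) (3 + j) := by rw [← hi, ← hj, g.vtx_row_col]
      have last : (g.vtx (c i) (d j), t) ∈ Z ∪ (slots K).image ψ := by
        rw [ht]; exact one (.inr (.inr (i, j))) (by simp [slots, hik, hjk])
      rcases hs with hs | hs
      · have hs' : s = g.vtx 1 2 := by rw [← hs.1, ← hs.2, g.vtx_row_col]
        refine ((Relation.ReflTransGen.single (b := g.vtx (c i) 0) ?_).tail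
          (c := g.vtx (c i) (d j)) ?_).tail last
        · rw [hs']; exact one (.inl i) (by simp [slots, hik])
        · refine zero _ _ (Or.inl ?_)
          rw [g.row_vtx, g.col_vtx, g.row_vtx, g.col_vtx] <;> omega
      · have hs' : s = g.vtx 2 1 := by rw [← hs.1, ← hs.2, g.vtx_row_col]
        refine ((Relation.ReflTransGen.single (b := g.vtx 0 (d j)) ?_).tail
          (c := g.vtx (c i) (d j)) ?_).tail last
        · rw [hs']; exact one (.inr (.inl j)) (by simp [slots, hjk])
        · refine zero _ _ (Or.inr (Or.inl ?_))
          rw [g.row_vtx, g.col_vtx, g.row_vtx, g.col_vtx] <;> omega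
    · exact Relation.ReflTransGen.single (zero _ _ (Or.inr (Or.inr h)))
  · refine (Finset.card_le_card (t := (slots K).image ψ) fun e he => ?_).trans
      (Finset.card_image_le.trans (card_slots K).le)
    obtain ⟨he, h1⟩ := Finset.mem_filter.1 he
    rcases Finset.mem_union.1 he with h | h
    · exact absurd (Finset.mem_filter.1 h).2 (not_gridZero_of_gridOne h1)
    · exact h

end Grid

/-! ## Instances given by matrices of numbers -/

theorem matrixWord_eq {n : ℕ} (f : ℕ → ℕ → ℕ) :
    matrixWord (fun u v : Fin n => f u v) =
      (List.range n).flatMap fun u => (List.range n).map (f u) := by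
  have h : ∀ {β : Type} (g : ℕ → β), List.ofFn (fun u : Fin n => g u) = (List.range n).map g := by
    intro β g
    apply List.ext_getElem <;> simp
  simp only [matrixWord, h (f _), h fun u => (List.range n).map (f u), List.flatMap_def]

/-- All rows have length `n`, so the flattening can be undone. -/
theorem matrixWord_injective {n : ℕ} {A B : Fin n → Fin n → ℕ}
    (h : matrixWord A = matrixWord B) : A = B := by
  have hl : ∀ C : Fin n → Fin n → ℕ,
      (List.ofFn fun u => List.ofFn (C u)).map List.length = List.replicate n n := by
    intro C
    apply List.ext_getElem <;> simp
  have := List.eq_iff_flatten_eq.2 ⟨h, (hl A).trans (hl B).symm⟩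
  funext u
  exact List.ofFn_injective (congrFun (List.ofFn_injective this) u)

theorem length_matrixWord {n : ℕ} (A : Fin n → Fin n → ℕ) : (matrixWord A).length = n * n := by
  simp [matrixWord, List.length_flatten, List.map_ofFn, Function.comp_def]

/-- Membership in `dsnProblem` speaks of some instance with the given code; injectivity makes it a
statement on the instance at hand. The first entry `n` fixes the lengths of the blocks. -/
theorem DSNInstance.encode_injective {I J : DSNInstance} (h : I.encode = J.encode) : I = J := by
  obtain ⟨n, arc, S, H, b⟩ := I
  obtain ⟨n', arc', S', H', b'⟩ := J
  simp only [encode, List.cons.injEq] at h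
  obtain ⟨rfl, rfl, h⟩ := h
  obtain ⟨h, harc⟩ := List.append_inj h (by simp [length_matrixWord])
  obtain ⟨hS, hH⟩ := List.append_inj h (by simp)
  have hS := List.ofFn_injective hS
  have hH := matrixWord_injective hH
  have harc := matrixWord_injective harc
  obtain rfl : S = S' := by
    ext v
    have := congrFun hS v
    by_cases h1 : v ∈ S <;> by_cases h2 : v ∈ S' <;> simp_all
  obtain rfl : H = H' := by
    ext u v
    have := congrFun (congrFun hH u.1) v.1
    by_cases h1 : H.Adj u v <;> by_cases h2 : H'.Adj u v <;> simp_all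
  obtain rfl : arc = arc' := by
    funext u v
    have := congrFun (congrFun harc u) v
    cases h1 : arc u v <;> cases h2 : arc' u v <;> simp_all
  rfl

/-- The instance with all arcs and all edges of the pattern reversed. -/
def DSNInstance.reverse (I : DSNInstance) : DSNInstance where
  n := I.n
  arc u v := I.arc v u
  terminals := I.terminals
  pattern := ⟨fun u v => I.pattern.Adj v u⟩
  budget := I.budget

theorem DSNInstance.Feasible.reverse {I : DSNInstance} (h : I.Feasible) : I.reverse.Feasible := by
  obtain ⟨N, ⟨harc, hpath⟩, hcost⟩ := h
  let σ : Fin I.n × Fin I.n ≃ Fin I.n × Fin I.n := Equiv.prodComm _ _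
  refine ⟨N.map σ.toEmbedding, ⟨fun e he => ?_, fun s t hst => ?_⟩, ?_⟩
  · obtain ⟨e, he', rfl⟩ := Finset.mem_map.1 he
    exact harc e he'
  · have h : ∀ u v, Relation.ReflTransGen (fun u v => (u, v) ∈ N) u v →
        Relation.ReflTransGen (fun u v => (u, v) ∈ N.map σ.toEmbedding) v u := by
      intro u v huv
      induction huv with
      | refl => exact .refl
      | tail _ h ih => exact .head (Finset.mem_map.2 ⟨_, h, rfl⟩) ih
    exact h _ _ (hpath t s hst)
  · exact (Finset.sum_map N σ.toEmbedding fun e => (I.arc e.2 e.1).getD 0).le.trans hcost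

theorem DSNInstance.feasible_reverse {I : DSNInstance} : I.reverse.Feasible ↔ I.Feasible :=
  ⟨fun h => h.reverse, fun h => h.reverse⟩

open Classical in
/-- The instance on `n` vertices with given terminals, pattern, and matrix of weights. -/
noncomputable def DSNInstance.ofEntries (n b : ℕ) (term : ℕ → Prop) (pat : ℕ → ℕ → Prop)
    (entry : ℕ → ℕ → ℕ) : DSNInstance where
  n := n
  arc u v := if entry u v = 0 then none else some (entry u v - 1)
  terminals := Finset.univ.filter fun v => term v
  pattern := ⟨fun u v => pat u.1 v.1⟩
  budget := b

open Classical in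
theorem DSNInstance.encode_ofEntries (n b : ℕ) {term : ℕ → Prop} {pat : ℕ → ℕ → Prop}
    (hpat : ∀ u v, pat u v → term u ∧ term v) (entry : ℕ → ℕ → ℕ) :
    (ofEntries n b term pat entry).encode =
      n :: b :: (((List.range n).map fun v => if term v then 1 else 0) ++
        ((List.range n).flatMap fun u => (List.range n).map fun v => if pat u v then 1 else 0) ++
        (List.range n).flatMap fun u => (List.range n).map (entry u)) := by
  have h1 : (List.ofFn fun v : Fin n => if term v then 1 else 0) =
      (List.range n).map fun v => if term v then 1 else 0 := by
    apply List.ext_getElem <;> simp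
  rw [← h1, ← matrixWord_eq, ← matrixWord_eq]
  set I := ofEntries n b term pat entry
  have hmem : ∀ v, v ∈ I.terminals ↔ term v := fun v =>
    ⟨fun h => (Finset.mem_filter.1 h).2, fun h => Finset.mem_filter.2 ⟨Finset.mem_univ _, h⟩⟩
  have h2 : ∀ u v, (∃ (hu : u ∈ I.terminals) (hv : v ∈ I.terminals),
      I.pattern.Adj ⟨u, hu⟩ ⟨v, hv⟩) ↔ pat u v := fun u v =>
    ⟨fun ⟨_, _, h⟩ => h, fun h => ⟨(hmem u).2 (hpat u v h).1, (hmem v).2 (hpat u v h).2, h⟩⟩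
  have h3 : ∀ u v, (I.arc u v).elim 0 (· + 1) = entry u v := by
    intro u v
    change Option.elim (if entry u v = 0 then none else some (entry u v - 1)) 0 (· + 1) = _
    split_ifs with h
    · exact h.symm
    · exact Nat.sub_add_cancel (Nat.pos_of_ne_zero h)
  simp only [encode, h2, h3]
  simp only [hmem]
  rfl

theorem DSNInstance.reverse_ofEntries (n b : ℕ) (term : ℕ → Prop) (pat : ℕ → ℕ → Prop)
    (entry : ℕ → ℕ → ℕ) : (ofEntries n b term pat entry).reverse =
      ofEntries n b term (fun u v => pat v u) (fun u v => entry v u) := rfl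

theorem mem_dsnProblem_iff {H : PatternClass} {I : DSNInstance} (hI : H _ I.pattern) :
    (I.encode, I.terminals.card) ∈ dsnProblem H ↔ I.Feasible := by
  refine ⟨?_, fun h => ⟨I, hI, rfl, rfl, h⟩⟩
  rintro ⟨J, _, h, _, hJ⟩
  obtain rfl := DSNInstance.encode_injective h
  exact hJ

/-! ## The grid instance -/

/-- The standard grid on the numbers below `W * W`. -/
def finGrid (W : ℕ) [NeZero W] : Grid (Fin (W * W)) W where
  row u := u / W
  col u := u % W
  vtx a b := Fin.ofNat (W * W) (a * W + b)
  row_lt u := Nat.div_lt_of_lt_mul u.2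
  col_lt u := Nat.mod_lt _ (NeZero.pos W)
  row_vtx a b ha hb := by
    have : a * W + b < W * W := by nlinarith
    simp only [Fin.ofNat, Nat.mod_eq_of_lt this]
    rw [Nat.add_comm, Nat.add_mul_div_right _ _ (NeZero.pos W), Nat.div_eq_of_lt hb, Nat.zero_add]
  col_vtx a b ha hb := by
    have : a * W + b < W * W := by nlinarith
    simp only [Fin.ofNat, Nat.mod_eq_of_lt this]
    rw [Nat.add_comm, Nat.add_mul_mod_self_right, Nat.mod_eq_of_lt hb]
  vtx_row_col u := by
    apply Fin.ext
    simp only [Fin.ofNat, Nat.div_add_mod', Nat.mod_eq_of_lt u.2]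

open Classical in
/-- The matrix entry of the grid network. -/
noncomputable def gridEntry (K : ℕ) (T : ℕ → ℕ) (R : ℕ → ℕ → Prop) (a b a' b' : ℕ) : ℕ :=
  if gridOne K T R a b a' b' then 2 else if gridZero K a b a' b' then 1 else 0

/-- The grid network as an instance of Directed Steiner Network. -/
noncomputable def gridInstance (K W : ℕ) (T : ℕ → ℕ) (R : ℕ → ℕ → Prop) : DSNInstance :=
  DSNInstance.ofEntries (W * W) (2 * K + K * K) (fun u => gridTerm K (u / W) (u % W))
    (fun u v => gridPat K (u / W) (u % W) (v / W) (v % W))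
    (fun u v => gridEntry K T R (u / W) (u % W) (v / W) (v % W))

theorem gridInstance_feasible_iff {K W : ℕ} (hK : 0 < K) (hW : 3 + K ≤ W) (T : ℕ → ℕ)
    (R : ℕ → ℕ → Prop) : (gridInstance K W T R).Feasible ↔
      ∃ c d : ℕ → ℕ, ∀ i < K, ∀ j < K, c i < W ∧ d j < W ∧ 3 + K ≤ c i ∧ 3 + K ≤ d j ∧
        T (c i) = i ∧ T (d j) = j ∧ R (c i) (d j) := by
  classical
  have : NeZero W := ⟨by omega⟩
  set g := finGrid W with hg
  have hsome : ∀ u v : Fin (W * W), ((gridInstance K W T R).arc u v).isSome ↔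
      gridOne K T R (g.row u) (g.col u) (g.row v) (g.col v) ∨
        gridZero K (g.row u) (g.col u) (g.row v) (g.col v) := by
    intro u v
    change Option.isSome (if gridEntry K T R (g.row u) (g.col u) (g.row v) (g.col v) = 0 then none
      else some (gridEntry K T R (g.row u) (g.col u) (g.row v) (g.col v) - 1)) ↔ _
    simp only [gridEntry]
    split_ifs <;> simp_all
  have hwt : ∀ u v : Fin (W * W), ((gridInstance K W T R).arc u v).getD 0 =
      if gridOne K T R (g.row u) (g.col u) (g.row v) (g.col v) then 1 else 0 := by
    intro u v
    change Option.getD (if gridEntry K T R (g.row u) (g.col u) (g.row v) (g.col v) = 0 then none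
      else some (gridEntry K T R (g.row u) (g.col u) (g.row v) (g.col v) - 1)) 0 = _
    simp only [gridEntry]
    split_ifs <;> simp_all
  have hcost : ∀ N : Finset (Fin (W * W) × Fin (W * W)), (gridInstance K W T R).cost N =
      (N.filter fun e => gridOne K T R (g.row e.1) (g.col e.1) (g.row e.2) (g.col e.2)).card := by
    intro N
    rw [Finset.card_filter]
    exact Finset.sum_congr rfl fun e _ => hwt e.1 e.2
  constructor
  · rintro ⟨N, ⟨h1, h2⟩, h3⟩
    refine g.choice_of_cheap hK hW (N := N) (fun u v h => (hsome u v).1 (h1 _ h))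
      (fun s t hst => ?_) ((hcost N).ge.trans h3)
    have ht := gridPat_term hst
    exact h2 ⟨s, Finset.mem_filter.2 ⟨Finset.mem_univ _, ht.1⟩⟩
      ⟨t, Finset.mem_filter.2 ⟨Finset.mem_univ _, ht.2⟩⟩ hst
  · rintro ⟨c, d, hcd⟩
    obtain ⟨N, h1, h2, h3⟩ := g.cheap_of_choice hW hcd
    exact ⟨N, ⟨fun e he => (hsome e.1 e.2).2 (h1 _ _ he), fun s t hst => h2 s.1 t.1 hst⟩,
      (hcost N).le.trans h3⟩

/-! ### The terminals of the grid as a flawed diamond -/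

/-- The position in the grid of a vertex of a flawed diamond. -/
def diamondCoord (K : ℕ) : FlawedDiamondVertex (K * K) → ℕ × ℕ
  | .x => (0, 0)
  | .root i => if i = 0 then (1, 2) else (2, 1)
  | .leaf l => (3 + l / K, 3 + l % K)

theorem diamondCoord_leaf {K : ℕ} (l : Fin (K * K)) :
    ∃ p q, diamondCoord K (.leaf l) = (3 + p, 3 + q) ∧ p < K ∧ q < K ∧ (l : ℕ) = p * K + q :=
  ⟨l / K, l % K, rfl, Nat.div_lt_of_lt_mul l.2, Nat.mod_lt _ (Nat.pos_of_ne_zero (by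
    rintro rfl; exact absurd l.2 (by simp))), (Nat.div_add_mod' _ _).symm⟩

theorem diamondCoord_root (K : ℕ) (i : Fin 2) :
    (i = 0 ∧ diamondCoord K (.root i) = (1, 2)) ∨ (i = 1 ∧ diamondCoord K (.root i) = (2, 1)) := by
  fin_cases i <;> simp [diamondCoord]

theorem gridTerm_diamondCoord {K : ℕ} (s : FlawedDiamondVertex (K * K)) :
    gridTerm K (diamondCoord K s).1 (diamondCoord K s).2 := by
  rcases s with i | l | _
  · rcases diamondCoord_root K i with ⟨_, h⟩ | ⟨_, h⟩ <;> simp [h, gridTerm]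
  · obtain ⟨p, q, h, h1, h2, _⟩ := diamondCoord_leaf l
    simp [h, gridTerm, h1, h2]
  · simp [diamondCoord, gridTerm]

theorem diamondCoord_injective (K : ℕ) : Function.Injective (diamondCoord K) := by
  intro s t hst
  rcases s with i | l | _ <;> rcases t with j | l' | _
  · rcases diamondCoord_root K i with ⟨rfl, h⟩ | ⟨rfl, h⟩ <;>
      rcases diamondCoord_root K j with ⟨rfl, h'⟩ | ⟨rfl, h'⟩ <;> simp_all
  · obtain ⟨p, q, h', _⟩ := diamondCoord_leaf l'
    rw [h'] at hst
    rcases diamondCoord_root K i with ⟨rfl, h⟩ | ⟨rfl, h⟩ <;> rw [h, Prod.mk.injEq] at hst <;>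
      omega
  · rcases diamondCoord_root K i with ⟨rfl, h⟩ | ⟨rfl, h⟩ <;> rw [h] at hst <;>
      simp [diamondCoord] at hst
  · obtain ⟨p, q, h', _⟩ := diamondCoord_leaf l
    rw [h'] at hst
    rcases diamondCoord_root K j with ⟨rfl, h⟩ | ⟨rfl, h⟩ <;> rw [h, Prod.mk.injEq] at hst <;>
      omega
  · obtain ⟨p, q, h, _, _, e⟩ := diamondCoord_leaf l
    obtain ⟨p', q', h', _, _, e'⟩ := diamondCoord_leaf l'
    rw [h, h', Prod.mk.injEq] at hst
    obtain rfl : p = p' := by omega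
    obtain rfl : q = q' := by omega
    rw [Fin.ext (e.trans e'.symm)]
  · obtain ⟨p, q, h', _⟩ := diamondCoord_leaf l
    rw [h'] at hst
    simp [diamondCoord] at hst
  · rcases diamondCoord_root K j with ⟨rfl, h⟩ | ⟨rfl, h⟩ <;> rw [h] at hst <;>
      simp [diamondCoord] at hst
  · obtain ⟨p, q, h', _⟩ := diamondCoord_leaf l'
    rw [h'] at hst
    simp [diamondCoord] at hst
    omega
  · rfl

theorem exists_diamondCoord {K a b : ℕ} (h : gridTerm K a b) : ∃ s, diamondCoord K s = (a, b) := by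
  rcases h with h | h | h | ⟨h1, h2, h3, h4⟩
  · exact ⟨.x, by simp [diamondCoord, h]⟩
  · exact ⟨.root 0, by simp [diamondCoord, h]⟩
  · exact ⟨.root 1, by simp [diamondCoord, h]⟩
  · have hb : b - 3 < K := by omega
    have ha : a - 3 < K := by omega
    refine ⟨.leaf ⟨(a - 3) * K + (b - 3), by nlinarith⟩, ?_⟩
    simp only [diamondCoord]
    rw [Nat.add_comm ((a - 3) * K), Nat.add_mul_div_right _ _ (by omega),
      Nat.add_mul_mod_self_right, Nat.div_eq_of_lt hb, Nat.mod_eq_of_lt hb]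
    ext <;> simp only <;> omega

theorem not_gridPat_of_leaf {K a b a' b' : ℕ} (h : 3 ≤ a) : ¬ gridPat K a b a' b' := by
  simp only [gridPat]; omega

theorem gridPat_diamondCoord {K : ℕ} (s t : FlawedDiamondVertex (K * K)) :
    gridPat K (diamondCoord K s).1 (diamondCoord K s).2 (diamondCoord K t).1 (diamondCoord K t).2 ↔
      (flawedOutDiamond (K * K)).Adj s t := by
  rcases s with i | l | _ <;> rcases t with j | l' | _
  · rcases diamondCoord_root K i with ⟨_, h⟩ | ⟨_, h⟩ <;>
      rcases diamondCoord_root K j with ⟨_, h'⟩ | ⟨_, h'⟩ <;>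
      simp [h, h', gridPat, flawedOutDiamond]
  · obtain ⟨p, q, h', h1, h2, _⟩ := diamondCoord_leaf l'
    rcases diamondCoord_root K i with ⟨_, h⟩ | ⟨_, h⟩ <;>
      simp [h, h', gridPat, flawedOutDiamond, h1, h2]
  · have hx : diamondCoord K .x = (0, 0) := rfl
    rcases diamondCoord_root K i with ⟨_, h⟩ | ⟨_, h⟩ <;>
      simp [h, hx, gridPat, flawedOutDiamond]
  · exact iff_of_false (not_gridPat_of_leaf (Nat.le_add_right _ _)) id
  · exact iff_of_false (not_gridPat_of_leaf (Nat.le_add_right _ _)) id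
  · exact iff_of_false (not_gridPat_of_leaf (Nat.le_add_right _ _)) id
  · have hx : diamondCoord K .x = (0, 0) := rfl
    rcases diamondCoord_root K j with ⟨_, h⟩ | ⟨_, h⟩ <;>
      simp [h, hx, gridPat, flawedOutDiamond]
  · obtain ⟨p, q, h', h1, h2, _⟩ := diamondCoord_leaf l'
    have hx : diamondCoord K .x = (0, 0) := rfl
    refine iff_of_false ?_ id
    simp only [h', hx, gridPat]
    omega
  · simp [diamondCoord, gridPat, flawedOutDiamond]

/-- The terminals of the grid network correspond to the vertices of a flawed diamond. -/
theorem exists_terminal_equiv {K W : ℕ} (hW : 3 + K ≤ W) (T : ℕ → ℕ)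
    (R : ℕ → ℕ → Prop) :
    ∃ f : FlawedDiamondVertex (K * K) ≃
        {v // v ∈ (gridInstance K W T R).terminals},
      ∀ s t, (gridInstance K W T R).pattern.Adj (f s) (f t) ↔ (flawedOutDiamond (K * K)).Adj s t := by
  classical
  have : NeZero W := ⟨by omega⟩
  set g := finGrid W with hg
  have hmem : ∀ v, v ∈ (gridInstance K W T R).terminals ↔ gridTerm K (g.row v) (g.col v) :=
    fun v => ⟨fun h => (Finset.mem_filter.1 h).2,
      fun h => Finset.mem_filter.2 ⟨Finset.mem_univ _, h⟩⟩
  let co := diamondCoord K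
  have hlt : ∀ s, (co s).1 < W ∧ (co s).2 < W := by
    intro s
    have h := gridTerm_diamondCoord s
    simp only [gridTerm] at h
    simp only [co]
    omega
  have hrow : ∀ s, g.row (g.vtx (co s).1 (co s).2) = (co s).1 := fun s =>
    g.row_vtx _ _ (hlt s).1 (hlt s).2
  have hcol : ∀ s, g.col (g.vtx (co s).1 (co s).2) = (co s).2 := fun s =>
    g.col_vtx _ _ (hlt s).1 (hlt s).2
  let f : FlawedDiamondVertex (K * K) → {v // v ∈ (gridInstance K W T R).terminals} := fun s =>
    ⟨g.vtx (co s).1 (co s).2, (hmem _).2 (by rw [hrow, hcol]; exact gridTerm_diamondCoord s)⟩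
  have hinj : Function.Injective f := by
    intro s t hst
    refine diamondCoord_injective K (Prod.ext ?_ ?_)
    · rw [← hrow s, ← hrow t]; exact congrArg (fun v => g.row v.1) hst
    · rw [← hcol s, ← hcol t]; exact congrArg (fun v => g.col v.1) hst
  have hsurj : Function.Surjective f := by
    rintro ⟨v, hv⟩
    obtain ⟨s, hs⟩ := exists_diamondCoord ((hmem v).1 hv)
    exact ⟨s, Subtype.ext ((congrArg₂ g.vtx (congrArg Prod.fst hs) (congrArg Prod.snd hs)).trans
      (g.vtx_row_col v))⟩
  refine ⟨Equiv.ofBijective f ⟨hinj, hsurj⟩, fun s t => ?_⟩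
  change gridPat K (g.row (g.vtx (co s).1 (co s).2)) (g.col (g.vtx (co s).1 (co s).2))
    (g.row (g.vtx (co t).1 (co t).2)) (g.col (g.vtx (co t).1 (co t).2)) ↔ _
  simp only [hrow, hcol]
  exact gridPat_diamondCoord s t

theorem card_terminals_gridInstance {K W : ℕ} (hW : 3 + K ≤ W) (T : ℕ → ℕ)
    (R : ℕ → ℕ → Prop) : (gridInstance K W T R).terminals.card = K * K + 3 := by
  obtain ⟨f, _⟩ := exists_terminal_equiv hW T R
  let e : FlawedDiamondVertex (K * K) ≃ Fin 2 ⊕ Fin (K * K) ⊕ Unit :=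
    { toFun := fun
        | .root i => .inl i
        | .leaf l => .inr (.inl l)
        | .x => .inr (.inr ())
      invFun := fun
        | .inl i => .root i
        | .inr (.inl l) => .leaf l
        | .inr (.inr _) => .x
      left_inv := by rintro (_ | _ | _) <;> rfl
      right_inv := by rintro (_ | _ | _) <;> rfl }
  have := Fintype.card_congr (f.symm.trans e)
  rw [Fintype.card_coe] at this
  rw [this]
  simp; ring

theorem flawedOutDiamonds_gridInstance {K W : ℕ} (hK : 0 < K) (hW : 3 + K ≤ W) (T : ℕ → ℕ)
    (R : ℕ → ℕ → Prop) : flawedOutDiamonds _ (gridInstance K W T R).pattern := by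
  obtain ⟨f, hf⟩ := exists_terminal_equiv hW T R
  refine ⟨K * K, Nat.mul_pos hK hK, ⟨⟨f.symm, fun {s t} => ?_⟩⟩⟩
  have := hf (f.symm s) (f.symm t)
  simpa using this.symm

theorem flawedInDiamonds_reverse_gridInstance {K W : ℕ} (hK : 0 < K) (hW : 3 + K ≤ W)
    (T : ℕ → ℕ) (R : ℕ → ℕ → Prop) :
    flawedInDiamonds _ (gridInstance K W T R).reverse.pattern := by
  obtain ⟨f, hf⟩ := exists_terminal_equiv hW T R
  refine ⟨K * K, Nat.mul_pos hK hK, ⟨⟨f.symm, fun {s t} => ?_⟩⟩⟩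
  have h1 : ∀ a b, (flawedInDiamond (K * K)).Adj a b ↔ (flawedOutDiamond (K * K)).Adj b a := by
    rintro (_ | _ | _) (_ | _ | _) <;> simp [flawedInDiamond, flawedOutDiamond]
  have h2 : ∀ a b, (flawedOutDiamond (K * K)).Adj (f.symm a) (f.symm b) ↔
      (gridInstance K W T R).pattern.Adj a b := fun a b => by
    have := (hf (f.symm a) (f.symm b)).symm
    rwa [f.apply_symm_apply, f.apply_symm_apply] at this
  exact (h1 _ _).trans (h2 t s)

/-! ## Tableaux of computations -/

/-- A row of a tableau: a possible step of a machine with the information that is needed to check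
it against the other steps.  The positions of the head are shifted to be natural numbers. -/
structure TableauRow : Type where
  time : ℕ
  state : ℕ
  newState : ℕ
  read : ℕ
  write : ℕ
  pos : ℕ
  /-- one more than the next position -/
  nextPos : ℕ
  /-- one more than the time of the last visit to the current cell; `0` if there is none -/
  last : ℕ

/-- The row `r` may precede the row `s`. -/
def TableauRow.Compat (r s : TableauRow) : Prop :=
  (s.time = r.time + 1 → r.newState = s.state ∧ s.pos + 1 = r.nextPos) ∧
    (s.last = r.time + 1 → r.pos = s.pos ∧ r.write = s.read) ∧
    (s.last ≤ r.time → r.pos ≠ s.pos)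

/-- The row number `a` of a tableau, eight numbers for each row. -/
def tableauRow (w : List ℕ) (a : ℕ) : TableauRow where
  time := w.getD (8 * a) 0
  state := w.getD (8 * a + 1) 0
  newState := w.getD (8 * a + 2) 0
  read := w.getD (8 * a + 3) 0
  write := w.getD (8 * a + 4) 0
  pos := w.getD (8 * a + 5) 0
  nextPos := w.getD (8 * a + 6) 0
  last := w.getD (8 * a + 7) 0

/-- The problem to choose from a list of rows one row for each of the times `0, …, k` such that
the chosen rows are compatible. -/
def tableauProblem : ParamProblem :=
  {p | ∃ c : ℕ → ℕ, (∀ i ≤ p.2, c i < p.1.length / 8 ∧ (tableauRow p.1 (c i)).time = i) ∧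
    ∀ i j, i < j → j ≤ p.2 → (tableauRow p.1 (c i)).Compat (tableauRow p.1 (c j))}

/-- The displacement of the head plus one. -/
def NTMTransition.offset (τ : NTMTransition) : ℕ :=
  if τ.move = 0 then 0 else if τ.move = 1 then 2 else 1

theorem NTMTransition.offset_eq (τ : NTMTransition) : (τ.offset : ℤ) = τ.shift + 1 := by
  simp only [offset, shift]; split_ifs <;> simp

/-- The configuration after a transition. -/
def NTMTransition.apply (τ : NTMTransition) (c : NTMConfig) : NTMConfig :=
  ⟨τ.newState, c.head + τ.shift, Function.update c.tape c.head τ.write⟩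

/-- The row of a machine that has halted in the state `q`. -/
def TableauRow.idle (q t p : ℕ) : TableauRow := ⟨t, q, q, 0, 0, p, p + 1, t + 1⟩

/-- The row of a transition. -/
def NTMTransition.row (τ : NTMTransition) (t p l : ℕ) : TableauRow :=
  ⟨t, τ.state, τ.newState, τ.read, τ.write, p, p + τ.offset, l⟩

/-- The row can occur in a tableau of a computation of at most `k` steps. -/
def NTM.IsRow (M : NTM) (x : List ℕ) (k : ℕ) (r : TableauRow) : Prop :=
  (∃ t ≤ k, ∃ p ≤ 2 * k, (t = 0 → M.accept = M.start ∧ p = k) ∧ r = .idle M.accept t p) ∨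
    ∃ t < k, ∃ p ≤ 2 * k, ∃ l ≤ t, ∃ τ ∈ M.transitions, (t = 0 → τ.state = M.start ∧ p = k) ∧
      (l = 0 → τ.read = (M.initial x).tape ((p : ℤ) - k)) ∧ r = τ.row t p l

/-! ### Tape and head along a run, and the equivalence with tableaux -/

section Run

variable {c : ℕ → NTMConfig} {τ : ℕ → NTMTransition} {j : ℕ}

theorem tape_eq_of_not_visited (h : ∀ i < j, c (i + 1) = (τ i).apply (c i)) {a i : ℕ}
    (ha : a ≤ i) (hi : i ≤ j) {z : ℤ} (hz : ∀ s, a ≤ s → s < i → (c s).head ≠ z) :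
    (c i).tape z = (c a).tape z := by
  induction i, ha using Nat.le_induction with
  | base => rfl
  | succ i ha ih =>
    rw [← ih (by omega) fun s h1 h2 => hz s h1 (by omega), h i (by omega)]
    exact Function.update_of_ne (hz i ha (by omega)).symm _ _

theorem tape_eq_of_last_visit (h : ∀ i < j, c (i + 1) = (τ i).apply (c i)) {s i : ℕ}
    (hs : s < i) (hi : i ≤ j) (hsi : (c s).head = (c i).head)
    (hz : ∀ s', s < s' → s' < i → (c s').head ≠ (c i).head) :
    (c i).tape (c i).head = (τ s).write := by
  rw [tape_eq_of_not_visited h (a := s + 1) hs hi fun s' h1 h2 => hz s' h1 h2, h s (by omega),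
    ← hsi]
  exact Function.update_self _ _ _

theorem abs_head_le (h : ∀ i < j, c (i + 1) = (τ i).apply (c i)) (h0 : (c 0).head = 0) {i : ℕ}
    (hi : i ≤ j) : -(i : ℤ) ≤ (c i).head ∧ (c i).head ≤ i := by
  induction i with
  | zero => simp [h0]
  | succ i ih =>
    have := ih (by omega)
    rw [h i (by omega)]
    have h1 : -1 ≤ (τ i).shift ∧ (τ i).shift ≤ 1 := by
      simp only [NTMTransition.shift]; split_ifs <;> simp
    simp only [NTMTransition.apply]
    push_cast
    omega

end Run

/-- The rows are read off an accepting run of `j` steps; from time `j` on, the machine idles in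
place. Within `k` steps the head stays in `[-k, k]`, so the shift by `k` makes positions natural
numbers up to `2 * k`. -/
theorem NTM.exists_rows_of_acceptsWithin {M : NTM} {x : List ℕ} {k : ℕ}
    (hM : M.AcceptsWithin x k) :
    ∃ r : ℕ → TableauRow, (∀ i ≤ k, M.IsRow x k (r i) ∧ (r i).time = i) ∧
      ∀ i j, i < j → j ≤ k → (r i).Compat (r j) := by
  obtain ⟨j, c, hj, h0, hstep, hacc⟩ := hM
  have hstep' : ∀ i, ∃ τ : NTMTransition, i < j → τ ∈ M.transitions ∧ τ.state = (c i).state ∧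
      τ.read = (c i).tape (c i).head ∧ c (i + 1) = τ.apply (c i) := by
    intro i
    by_cases hi : i < j
    · obtain ⟨τ, h⟩ := hstep i hi
      exact ⟨τ, fun _ => h⟩
    · exact ⟨⟨0, 0, 0, 0, 0⟩, fun h => absurd h hi⟩
  choose τ hτ using hstep'
  have hrun : ∀ i < j, c (i + 1) = (τ i).apply (c i) := fun i hi => (hτ i hi).2.2.2
  have hhead : ∀ i ≤ j, -(i : ℤ) ≤ (c i).head ∧ (c i).head ≤ i := fun i hi =>
    abs_head_le hrun (by rw [h0]; rfl) hi
  let pos : ℕ → ℕ := fun i => ((c i).head + k).toNat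
  have hpos : ∀ i ≤ j, (pos i : ℤ) = (c i).head + k := fun i hi => by
    have := hhead i hi; simp only [pos]; omega
  have hpos0 : pos 0 = k := by simp [pos, h0, NTM.initial]
  -- The value `l` stands for a visit at time `l - 1`, and the default value `0` of the search
  -- stands for no visit.
  let last : ℕ → ℕ := fun i => Nat.findGreatest (fun l => (c (l - 1)).head = (c i).head) i
  have hlast : ∀ i, last i ≤ i := fun i => Nat.findGreatest_le i
  have hlast_eq : ∀ i s, last i = s + 1 → (c s).head = (c i).head := fun i s h => by
    have := Nat.findGreatest_of_ne_zero h (by omega)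
    simpa using this
  have hlast_ne : ∀ i s, last i ≤ s → s < i → (c s).head ≠ (c i).head := fun i s h1 h2 => by
    have := Nat.findGreatest_is_greatest (P := fun l => (c (l - 1)).head = (c i).head)
      (n := i) (k := s + 1) (by change last i < s + 1; omega) (by omega)
    simpa using this
  let r : ℕ → TableauRow := fun i =>
    if i < j then (τ i).row i (pos i) (last i) else .idle M.accept i (pos j)
  have hr1 : ∀ i, i < j → r i = (τ i).row i (pos i) (last i) := fun i hi => if_pos hi
  have hr2 : ∀ i, ¬ i < j → r i = .idle M.accept i (pos j) := fun i hi => if_neg hi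
  have htime : ∀ i, (r i).time = i := by
    intro i
    by_cases hi : i < j
    · rw [hr1 i hi]; rfl
    · rw [hr2 i hi]; rfl
  refine ⟨r, fun i hi => ⟨?_, htime i⟩, fun i i' hii' hi' => ⟨fun e => ?_, fun e => ?_, fun e => ?_⟩⟩
  · by_cases hij : i < j
    · obtain ⟨h1, h2, h3, _⟩ := hτ i hij
      have := hhead i hij.le
      have := hpos i hij.le
      refine Or.inr ⟨i, by omega, pos i, by omega, last i, hlast i, τ i, h1, fun h => ?_,
        fun h => ?_, hr1 i hij⟩
      · subst h; exact ⟨by rw [h2, h0]; rfl, hpos0⟩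
      · rw [h3, ← h0, tape_eq_of_not_visited hrun (Nat.zero_le i) hij.le
          fun s _ hs => hlast_ne i s (by omega) hs]
        congr 1; omega
    · have := hhead j le_rfl
      have := hpos j le_rfl
      refine Or.inl ⟨i, hi, pos j, by omega, fun h => ?_, hr2 i hij⟩
      have hj0 : j = 0 := by omega
      subst hj0
      exact ⟨by rw [← hacc, h0]; rfl, hpos0⟩
  · rw [htime, htime] at e
    subst e
    by_cases hij : i < j
    · have hs := hrun i hij
      have h1 := hpos i hij.le
      have h2 := hpos (i + 1) hij
      have h3 := (τ i).offset_eq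
      have h4 : (c (i + 1)).head = (c i).head + (τ i).shift := by rw [hs]; rfl
      have h5 : (τ i).newState = (c (i + 1)).state := by rw [hs]; rfl
      have h6 : pos (i + 1) + 1 = pos i + (τ i).offset := by omega
      rw [hr1 i hij]
      by_cases hij' : i + 1 < j
      · rw [hr1 _ hij']
        exact ⟨h5.trans (hτ _ hij').2.1.symm, h6⟩
      · rw [hr2 _ hij']
        obtain rfl : j = i + 1 := by omega
        exact ⟨h5.trans hacc, h6⟩
    · rw [hr2 i hij, hr2 (i + 1) (by omega)]
      exact ⟨rfl, rfl⟩
  · rw [htime] at e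
    by_cases hij : i' < j
    · rw [hr1 i' hij] at e ⊢
      rw [hr1 i (by omega)]
      have h1 := hlast_eq i' i e
      refine ⟨?_, ?_⟩
      · change pos i = pos i'
        have := hpos i (by omega)
        have := hpos i' (by omega)
        omega
      · change (τ i).write = (τ i').read
        rw [(hτ i' hij).2.2.1]
        refine (tape_eq_of_last_visit hrun hii' hij.le h1 fun s h2 h3 => ?_).symm
        exact hlast_ne i' s (by change last i' = i + 1 at e; omega) h3
    -- An idle row declares its own time as last visit, so earlier rows never trigger the conditions
    -- on the tape.
    · rw [hr2 i' hij] at e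
      change i' + 1 = i + 1 at e
      omega
  · rw [htime] at e
    by_cases hij : i' < j
    · rw [hr1 i' hij] at e ⊢
      rw [hr1 i (by omega)]
      have h1 := hlast_ne i' i e hii'
      change pos i ≠ pos i'
      have := hpos i (by omega)
      have := hpos i' (by omega)
      omega
    · rw [hr2 i' hij] at e
      change i' + 1 ≤ i at e
      omega

/-- The rows before the first idle row are transitions and are run one after another. The conditions
on consecutive times give state and head; those on last visits give the symbol read. -/
theorem NTM.acceptsWithin_of_rows {M : NTM} {x : List ℕ} {k : ℕ} {r : ℕ → TableauRow}
    (hrow : ∀ i ≤ k, M.IsRow x k (r i) ∧ (r i).time = i)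
    (hcompat : ∀ i j, i < j → j ≤ k → (r i).Compat (r j)) : M.AcceptsWithin x k := by
  classical
  -- Transition rows have times below `k`, so the row of time `k` must be idle.
  have hidle : ∃ j, j ≤ k ∧ ∃ p, r j = .idle M.accept j p := by
    refine ⟨k, le_rfl, ?_⟩
    obtain ⟨h, ht⟩ := hrow k le_rfl
    rcases h with ⟨t, _, p, _, _, h⟩ | ⟨t, h1, p, _, l, _, τ, _, _, _, h⟩
    · rw [h] at ht ⊢
      exact ⟨p, by rw [← (show t = k from ht)]⟩
    · rw [h] at ht
      exact absurd (show t = k from ht) h1.ne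
  let j := Nat.find hidle
  obtain ⟨hjk, pj, hpj⟩ := Nat.find_spec hidle
  have hnormal : ∀ i, ∃ τ : NTMTransition, i < j → ∃ p l, l ≤ i ∧ τ ∈ M.transitions ∧
      (i = 0 → τ.state = M.start ∧ p = k) ∧
      (l = 0 → τ.read = (M.initial x).tape ((p : ℤ) - k)) ∧ r i = τ.row i p l := by
    intro i
    by_cases hi : i < j
    · obtain ⟨h, ht⟩ := hrow i (by omega)
      rcases h with ⟨t, _, p, _, _, h⟩ | ⟨t, h1, p, _, l, h2, τ, h3, h4, h5, h⟩
      · exfalso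
        refine Nat.find_min hidle hi ⟨by omega, p, ?_⟩
        rw [h] at ht ⊢
        rw [← (show t = i from ht)]
      · rw [h] at ht
        obtain rfl : t = i := ht
        exact ⟨τ, fun _ => ⟨p, l, h2, h3, h4, h5, h⟩⟩
    · exact ⟨⟨0, 0, 0, 0, 0⟩, fun h => absurd h hi⟩
  choose τ hτ using hnormal
  let c : ℕ → NTMConfig := fun i => Nat.rec (M.initial x) (fun i ci => (τ i).apply ci) i
  have hc : ∀ i < j, c (i + 1) = (τ i).apply (c i) := fun _ _ => rfl
  have hinv : ∀ i ≤ j, (c i).state = (r i).state ∧ (c i).head = ((r i).pos : ℤ) - k := by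
    intro i hi
    induction i with
    | zero =>
      obtain ⟨h, ht⟩ := hrow 0 (Nat.zero_le k)
      change M.start = _ ∧ (0 : ℤ) = _
      rcases h with ⟨t, _, p, _, h1, h⟩ | ⟨t, _, p, _, l, _, τ, _, h1, _, h⟩
      · rw [h] at ht ⊢
        obtain ⟨e1, e2⟩ := h1 ht
        exact ⟨e1.symm, by subst e2; simp [TableauRow.idle]⟩
      · rw [h] at ht ⊢
        obtain ⟨e1, e2⟩ := h1 ht
        exact ⟨e1.symm, by subst e2; simp [NTMTransition.row]⟩
    | succ i ih =>
      obtain ⟨h1, h2⟩ := ih (by omega)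
      obtain ⟨p, l, _, _, _, _, hr⟩ := hτ i hi
      obtain ⟨h3, h4⟩ := (hcompat i (i + 1) (by omega) (by omega)).1
        (by rw [(hrow i (by omega)).2, (hrow (i + 1) (by omega)).2])
      have h5 := (τ i).offset_eq
      rw [hr] at h2 h3 h4
      rw [hc i hi]
      refine ⟨h3, ?_⟩
      change (c i).head + (τ i).shift = _
      simp only [NTMTransition.row] at h2 h4
      omega
  refine ⟨j, c, hjk, rfl, fun i hi => ?_, ?_⟩
  · obtain ⟨p, l, hl, hmem, _, h0, hr⟩ := hτ i hi
    obtain ⟨h1, h2⟩ := hinv i hi.le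
    have hpos : (r i).pos = p := by rw [hr]; rfl
    have hlast : (r i).last = l := by rw [hr]; rfl
    -- The third clause of compatibility: after the declared last visit, at time `l - 1`, the cell
    -- is left alone. For `l = 0` it has never been visited.
    have hne : ∀ s, l ≤ s → s < i → (c s).head ≠ (c i).head := by
      intro s hs hsi
      have h3 := (hcompat s i hsi (by omega)).2.2
        (by rw [hlast, (hrow s (by omega)).2]; exact hs)
      have h4 := (hinv s (by omega)).2
      omega
    refine ⟨τ i, hmem, ?_, ?_, rfl⟩
    · rw [h1, hr]; rfl
    · rcases Nat.eq_zero_or_pos l with hl0 | hl0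
      · rw [h0 hl0, tape_eq_of_not_visited hc (Nat.zero_le i) hi.le
          fun s _ hs => hne s (by omega) hs, h2, hpos]
        rfl
      · obtain ⟨s, rfl⟩ : ∃ s, l = s + 1 := ⟨l - 1, by omega⟩
        obtain ⟨h3, h4⟩ := (hcompat s i (by omega) (by omega)).2.1
          (by rw [hlast, (hrow s (by omega)).2])
        obtain ⟨ps, ls, _, _, _, _, hrs⟩ := hτ s (by omega)
        have h5 := (hinv s (by omega)).2
        rw [tape_eq_of_last_visit hc (s := s) (by omega) hi.le (by omega)
          fun s' h6 h7 => hne s' (by omega) h7]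
        rw [hrs, hr] at h4
        exact h4.symm
  · rw [(hinv j le_rfl).1, hpj]; rfl

theorem NTM.acceptsWithin_iff_rows {M : NTM} {x : List ℕ} {k : ℕ} :
    M.AcceptsWithin x k ↔ ∃ r : ℕ → TableauRow, (∀ i ≤ k, M.IsRow x k (r i) ∧ (r i).time = i) ∧
      ∀ i j, i < j → j ≤ k → (r i).Compat (r j) :=
  ⟨exists_rows_of_acceptsWithin, fun ⟨_, h1, h2⟩ => acceptsWithin_of_rows h1 h2⟩

/-! ## Conditions and reductions by emission programs -/

/-- If all loop bounds are linear in `|w|`, with a factor depending on `k`, the running time is a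
fixed power of such a bound, and the power splits into a factor in `k` and one in `|w|`. -/
theorem FPTReducible.of_emitProg {P Q : ParamProblem} (A : EmitProg) (hA : A.WellScoped 0) (m : ℕ)
    (hb : ∀ w k, A.LoopsLE (k :: w) ((k + m) * (wordSize w + 1)) []) {g : ℕ → ℕ}
    (hg : Computable g)
    (h : ∀ w k, ∃ w' k', A.out (k :: w) [] = k' :: w' ∧ k' ≤ g k ∧
      ((w, k) ∈ P ↔ (w', k') ∈ Q)) : FPTReducible P Q := by
  refine ⟨A.compile 0, fun k => (k + (m + 5)) ^ A.size, g, A.size,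
    (Computable.id.nat_add (Computable.const _)).nat_pow_const _, hg, fun w k => ?_⟩
  obtain ⟨w', k', ho, hk, hiff⟩ := h w k
  obtain ⟨t, ht, he⟩ := A.exec_compile [] [] hA (hb w k)
  rw [List.nil_append, ho] at he
  refine ⟨w', k', t, _, he, ?_, hk, hiff⟩
  refine ht.trans ((A.time_le _).trans ?_)
  rw [← mul_pow]
  refine Nat.pow_le_pow_left ?_ _
  nlinarith

namespace RAMExpr

/-- A condition holds if its value is not zero. -/
def Holds (inp : List ℕ) (m : ℕ → ℕ) (c : RAMExpr) : Prop := c.eval inp m ≠ 0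

/-- The condition `a < b`. -/
def lt (a b : RAMExpr) : RAMExpr := .sub b a

/-- The condition `a ≤ b`. -/
def le (a b : RAMExpr) : RAMExpr := .sub (.add b (.const 1)) a

/-- Negation of a condition. -/
def not (p : RAMExpr) : RAMExpr := .sub (.const 1) p

/-- Disjunction of conditions. -/
def or (p q : RAMExpr) : RAMExpr := .add p q

/-- Conjunction of conditions. -/
def and (p q : RAMExpr) : RAMExpr := not (or (not p) (not q))

/-- Implication of conditions. -/
def imp (p q : RAMExpr) : RAMExpr := or (not p) q

/-- The condition `a = b`. -/
def eq (a b : RAMExpr) : RAMExpr := not (.add (.sub a b) (.sub b a))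

/-- The variable with a given number. -/
def var (i : ℕ) : RAMExpr := .mem (.const i)

variable (inp : List ℕ) (m : ℕ → ℕ) (a b p q : RAMExpr)

theorem holds_lt : (lt a b).Holds inp m ↔ a.eval inp m < b.eval inp m := by
  simp only [Holds, lt, eval]; omega

theorem holds_le : (le a b).Holds inp m ↔ a.eval inp m ≤ b.eval inp m := by
  simp only [Holds, le, eval]; omega

theorem holds_not : (not p).Holds inp m ↔ ¬ p.Holds inp m := by
  simp only [Holds, not, eval]; omega

theorem holds_or : (or p q).Holds inp m ↔ p.Holds inp m ∨ q.Holds inp m := by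
  simp only [Holds, or, eval]; omega

theorem holds_and : (and p q).Holds inp m ↔ p.Holds inp m ∧ q.Holds inp m := by
  simp only [and, holds_not, holds_or]; tauto

theorem holds_imp : (imp p q).Holds inp m ↔ (p.Holds inp m → q.Holds inp m) := by
  simp only [imp, holds_not, holds_or]; tauto

theorem holds_eq : (eq a b).Holds inp m ↔ a.eval inp m = b.eval inp m := by
  rw [eq, holds_not]
  simp only [Holds, eval]; omega

theorem eval_var (i : ℕ) : (var i).eval inp m = m i := rfl

end RAMExpr

namespace EmitProg

variable (inp : List ℕ) (A B : EmitProg) (e : RAMExpr) (i j : ℕ) (env : List ℕ)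

theorem out_skip : skip.out inp env = [] := rfl

theorem out_write : (write e).out inp env = [e.eval inp (envMem env)] := rfl

theorem out_seq : (seq A B).out inp env = A.out inp env ++ B.out inp env := rfl

open Classical in
theorem out_ite : (ite e A B).out inp env =
    if e.Holds inp (envMem env) then A.out inp env else B.out inp env := by
  simp only [out, RAMExpr.Holds]
  congr

theorem out_letVal :
    (letVal e A).out inp env = A.out inp (env ++ [e.eval inp (envMem env)]) := rfl

theorem out_letMul :
    (letMul i j A).out inp env = A.out inp (env ++ [envMem env i * envMem env j]) := rfl

theorem out_loop : (loop i A).out inp env =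
    (List.range (envMem env i)).flatMap fun v => A.out inp (env ++ [v]) := rfl

end EmitProg

/-- A loop over the vertices is programmed as two loops over the coordinates, so the program needs
no division and its loop bounds stay at `W` rather than `W * W`. -/
theorem flatMap_range_mul {β : Type} (m n : ℕ) (F : ℕ → ℕ → List β) :
    ((List.range m).flatMap fun a => (List.range n).flatMap (F a)) =
      (List.range (m * n)).flatMap fun u => F (u / n) (u % n) := by
  induction m with
  | zero => simp
  | succ m ih =>
    rw [List.range_succ, List.flatMap_append, ih, Nat.succ_mul, List.range_add,
      List.flatMap_append]
    congr 1
    simp only [List.flatMap_cons, List.flatMap_nil, List.append_nil, List.flatMap_map]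
    refine List.flatMap_congr fun b hb => ?_
    have hb := List.mem_range.1 hb
    rw [Nat.mul_comm m n, Nat.mul_add_div (by omega), Nat.mul_add_mod, Nat.div_eq_of_lt hb,
      Nat.mod_eq_of_lt hb, Nat.add_zero]

/-! ## From tableaux to Directed Steiner Network -/

/-- The compatibility of two rows chosen by the two roots. -/
def TableauRow.LinkCompat (r s : TableauRow) (same : Prop) : Prop :=
  (r.time = s.time ∧ same) ∨ (r.time < s.time ∧ r.Compat s) ∨ s.time < r.time

/-- Times are the colors, and row numbers are shifted by `3 + (k + 1)` to become grid coordinates.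
The link at `(j, j)` forces `c j = d j`, the links above the diagonal give compatibility, and those
below hold trivially. -/
theorem mem_tableauProblem_iff_link {w : List ℕ} {k W : ℕ}
    (hW : W = w.length / 8 + 3 + (k + 1)) :
    (w, k) ∈ tableauProblem ↔ ∃ c d : ℕ → ℕ, ∀ i < k + 1, ∀ j < k + 1, c i < W ∧ d j < W ∧
      3 + (k + 1) ≤ c i ∧ 3 + (k + 1) ≤ d j ∧
      (tableauRow w (c i - (3 + (k + 1)))).time = i ∧
      (tableauRow w (d j - (3 + (k + 1)))).time = j ∧
      (tableauRow w (c i - (3 + (k + 1)))).LinkCompat (tableauRow w (d j - (3 + (k + 1))))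
        (c i = d j) := by
  constructor
  · rintro ⟨c, hc, hcomp⟩
    simp only at hc hcomp
    refine ⟨fun i => c i + (3 + (k + 1)), fun i => c i + (3 + (k + 1)), fun i hi j hj => ?_⟩
    obtain ⟨h1, h2⟩ := hc i (by omega)
    obtain ⟨h3, h4⟩ := hc j (by omega)
    simp only [Nat.add_sub_cancel]
    refine ⟨by omega, by omega, by omega, by omega, h2, h4, ?_⟩
    simp only [TableauRow.LinkCompat, h2, h4]
    rcases lt_trichotomy i j with h | h | h
    · exact Or.inr (Or.inl ⟨h, hcomp i j h (by omega)⟩)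
    · exact Or.inl ⟨h, by rw [h]⟩
    · exact Or.inr (Or.inr h)
  · rintro ⟨c, d, h⟩
    refine ⟨fun i => c i - (3 + (k + 1)), fun i hi => ?_, fun i j hij hj => ?_⟩
    · simp only at hi ⊢
      obtain ⟨h1, _, h2, _, h3, _⟩ := h i (by omega) i (by omega)
      exact ⟨by omega, h3⟩
    · simp only at hj ⊢
      obtain ⟨_, _, _, _, e1, e2, h1⟩ := h j (by omega) j (by omega)
      obtain ⟨_, _, _, _, e3, e4, h2⟩ := h i (by omega) j (by omega)
      simp only [TableauRow.LinkCompat, e1, e2, e3] at h1 h2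
      have h3 : c j = d j := by
        rcases h1 with h1 | h1 | h1
        · exact h1.2
        · omega
        · omega
      rcases h2 with h2 | h2 | h2
      · omega
      · rw [h3]; exact h2.2
      · omega

open RAMExpr

/-- Field `f` of the row at position `e` of the grid. -/
def rowField (e : RAMExpr) (f : ℕ) : RAMExpr :=
  let d : RAMExpr := .sub e (.add (.const 3) (var 0))
  .input (.add (.add d.quad d.quad) (.const (f + 1)))

/-- The `1` added to the position skips the parameter, which precedes the word in the input. -/
theorem eval_rowField (k : ℕ) (w : List ℕ) (m : ℕ → ℕ) (e : RAMExpr) (f : ℕ) :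
    (rowField e f).eval (k :: w) m = w.getD (8 * (e.eval (k :: w) m - (3 + m 0)) + f) 0 := by
  simp only [rowField, eval, eval_quad, eval_var, ← Nat.add_assoc, List.getD_cons_succ]
  congr 2; omega

/-- The condition that two rows are linked. -/
def linkExpr (a b : RAMExpr) : RAMExpr :=
  or (and (eq (rowField a 0) (rowField b 0)) (eq a b))
    (or (and (lt (rowField a 0) (rowField b 0))
        (and (imp (eq (rowField b 0) (.add (rowField a 0) (.const 1)))
            (and (eq (rowField a 2) (rowField b 1))
              (eq (.add (rowField b 5) (.const 1)) (rowField a 6))))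
          (and (imp (eq (rowField b 7) (.add (rowField a 0) (.const 1)))
              (and (eq (rowField a 5) (rowField b 5)) (eq (rowField a 4) (rowField b 3))))
            (imp (le (rowField b 7) (rowField a 0)) (not (eq (rowField a 5) (rowField b 5)))))))
      (lt (rowField b 0) (rowField a 0)))

theorem holds_linkExpr (k : ℕ) (w : List ℕ) (m : ℕ → ℕ) (a b : RAMExpr) :
    (linkExpr a b).Holds (k :: w) m ↔
      (tableauRow w (a.eval (k :: w) m - (3 + m 0))).LinkCompat
        (tableauRow w (b.eval (k :: w) m - (3 + m 0)))
        (a.eval (k :: w) m = b.eval (k :: w) m) := by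
  simp only [linkExpr, holds_or, holds_and, holds_eq, holds_lt, holds_imp, holds_le, holds_not,
    eval_rowField, eval, TableauRow.LinkCompat, TableauRow.Compat, tableauRow, Nat.add_zero, ne_eq]

/-- The condition `gridOne`. -/
def gridOneExpr (a b a' b' : RAMExpr) : RAMExpr :=
  let S : RAMExpr := .add (.const 3) (var 0)
  or (and (eq a (.const 1)) (and (eq b (.const 2)) (and (le S a') (eq b' (.const 0)))))
    (or (and (eq a (.const 2)) (and (eq b (.const 1)) (and (eq a' (.const 0)) (le S b'))))
      (and (le S a) (and (le S b) (and (eq a' (.add (.const 3) (rowField a 0)))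
        (and (eq b' (.add (.const 3) (rowField b 0))) (and (lt a' S) (and (lt b' S)
          (linkExpr a b))))))))

/-- The condition `gridZero`. -/
def gridZeroExpr (a b a' b' : RAMExpr) : RAMExpr :=
  let S : RAMExpr := .add (.const 3) (var 0)
  or (and (le S a) (and (eq b (.const 0)) (and (eq a' a) (le S b'))))
    (or (and (eq a (.const 0)) (and (le S b) (and (le S a') (eq b' b))))
      (and (eq a (.const 0)) (and (eq b (.const 0))
        (or (and (eq a' (.const 1)) (eq b' (.const 2)))
          (and (eq a' (.const 2)) (eq b' (.const 1)))))))

/-- The condition `gridTerm`. -/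
def gridTermExpr (a b : RAMExpr) : RAMExpr :=
  let S : RAMExpr := .add (.const 3) (var 0)
  or (and (eq a (.const 0)) (eq b (.const 0)))
    (or (and (eq a (.const 1)) (eq b (.const 2)))
      (or (and (eq a (.const 2)) (eq b (.const 1)))
        (and (le (.const 3) a) (and (lt a S) (and (le (.const 3) b) (lt b S))))))

/-- The condition `gridPat`. -/
def gridPatExpr (a b a' b' : RAMExpr) : RAMExpr :=
  let S : RAMExpr := .add (.const 3) (var 0)
  or (and (or (and (eq a (.const 1)) (eq b (.const 2))) (and (eq a (.const 2)) (eq b (.const 1))))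
      (and (le (.const 3) a') (and (lt a' S) (and (le (.const 3) b') (lt b' S)))))
    (and (eq a (.const 0)) (and (eq b (.const 0))
      (or (and (eq a' (.const 1)) (eq b' (.const 2)))
        (and (eq a' (.const 2)) (eq b' (.const 1))))))

section Conditions

variable (k : ℕ) (w : List ℕ) (m : ℕ → ℕ) (a b a' b' : RAMExpr)

theorem holds_gridOneExpr : (gridOneExpr a b a' b').Holds (k :: w) m ↔
    gridOne (m 0) (fun α => (tableauRow w (α - (3 + m 0))).time)
      (fun α β => (tableauRow w (α - (3 + m 0))).LinkCompat (tableauRow w (β - (3 + m 0))) (α = β))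
      (a.eval (k :: w) m) (b.eval (k :: w) m) (a'.eval (k :: w) m) (b'.eval (k :: w) m) := by
  simp only [gridOneExpr, holds_or, holds_and, holds_eq, holds_lt, holds_le, eval_rowField, eval,
    holds_linkExpr, gridOne, eval_var, Nat.add_zero, tableauRow]

theorem holds_gridZeroExpr : (gridZeroExpr a b a' b').Holds (k :: w) m ↔
    gridZero (m 0) (a.eval (k :: w) m) (b.eval (k :: w) m) (a'.eval (k :: w) m)
      (b'.eval (k :: w) m) := by
  simp only [gridZeroExpr, holds_or, holds_and, holds_eq, holds_le, eval, gridZero, eval_var]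

theorem holds_gridTermExpr : (gridTermExpr a b).Holds (k :: w) m ↔
    gridTerm (m 0) (a.eval (k :: w) m) (b.eval (k :: w) m) := by
  simp only [gridTermExpr, holds_or, holds_and, holds_eq, holds_le, holds_lt, eval, gridTerm,
    eval_var]

theorem holds_gridPatExpr : (gridPatExpr a b a' b').Holds (k :: w) m ↔
    gridPat (m 0) (a.eval (k :: w) m) (b.eval (k :: w) m) (a'.eval (k :: w) m)
      (b'.eval (k :: w) m) := by
  simp only [gridPatExpr, holds_or, holds_and, holds_eq, holds_le, holds_lt, eval, gridPat,
    eval_var]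

end Conditions

/-- The program that writes the grid network of a tableau; the pattern and the arcs of weight one
and zero are given by the conditions `cp`, `co` and `cz`. -/
def gridProg (cp co cz : RAMExpr) : EmitProg :=
  -- Variables: 0 is `K = k + 1`, 1 the number of rows, 2 is `W`, 3 is `K * K`, 4 is `W * W`.
  -- Variables 5, 6 are the coordinates of the first vertex, 7, 8 those of the second.
  .letVal (.add (.input (.const 0)) (.const 1)) <|
  .letVal (.half (.half (.half (.sub .inputLen (.const 1))))) <|
  .letVal (.add (.add (var 1) (.const 3)) (var 0)) <|
  .letMul 0 0 <| .letMul 2 2 <|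
  .seq (.write (.add (var 3) (.const 3))) <|
  .seq (.write (var 4)) <|
  .seq (.write (.add (.add (var 0) (var 0)) (var 3))) <|
  .seq (.loop 2 (.loop 2 (.ite (gridTermExpr (var 5) (var 6)) (.write (.const 1))
    (.write (.const 0))))) <|
  .seq (.loop 2 (.loop 2 (.loop 2 (.loop 2 (.ite cp (.write (.const 1))
    (.write (.const 0))))))) <|
  .loop 2 (.loop 2 (.loop 2 (.loop 2 (.ite co (.write (.const 2))
    (.ite cz (.write (.const 1)) (.write (.const 0)))))))

theorem wellScoped_gridProg (cp co cz : RAMExpr) : (gridProg cp co cz).WellScoped 0 := by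
  simp [gridProg, EmitProg.WellScoped]

theorem loopsLE_gridProg (cp co cz : RAMExpr) (w : List ℕ) (k : ℕ) :
    (gridProg cp co cz).LoopsLE (k :: w) ((k + 10) * (wordSize w + 1)) [] := by
  have h := length_le_wordSize w
  have h1 : k + 1 ≤ (k + 10) * (wordSize w + 1) := by nlinarith
  have h2 : w.length / 2 / 2 / 2 + 3 + (k + 1) ≤ (k + 10) * (wordSize w + 1) := by
    have : w.length / 2 / 2 / 2 ≤ wordSize w := by omega
    nlinarith
  simp [gridProg, EmitProg.LoopsLE, eval, envMem, var, h1, h2]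

-- The conditions are left open so that the same computation serves the network and its reversal.
open Classical in
theorem out_gridProg {cp co cz : RAMExpr} {P O Z : ℕ → ℕ → ℕ → ℕ → Prop} (w : List ℕ) (k : ℕ)
    {K W : ℕ} (hK : K = k + 1) (hW : W = w.length / 8 + 3 + K)
    (hP : ∀ m a b a' b', m 0 = K → m 5 = a → m 6 = b → m 7 = a' → m 8 = b' →
      (cp.Holds (k :: w) m ↔ P a b a' b'))
    (hO : ∀ m a b a' b', m 0 = K → m 5 = a → m 6 = b → m 7 = a' → m 8 = b' →
      (co.Holds (k :: w) m ↔ O a b a' b'))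
    (hZ : ∀ m a b a' b', m 0 = K → m 5 = a → m 6 = b → m 7 = a' → m 8 = b' →
      (cz.Holds (k :: w) m ↔ Z a b a' b')) :
    (gridProg cp co cz).out (k :: w) [] = (K * K + 3) :: (W * W) :: (2 * K + K * K) ::
      (((List.range (W * W)).map fun v => if gridTerm K (v / W) (v % W) then 1 else 0) ++
        ((List.range (W * W)).flatMap fun u => (List.range (W * W)).map fun v =>
          if P (u / W) (u % W) (v / W) (v % W) then 1 else 0) ++
        (List.range (W * W)).flatMap fun u => (List.range (W * W)).map fun v =>
          if O (u / W) (u % W) (v / W) (v % W) then 2 else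
            if Z (u / W) (u % W) (v / W) (v % W) then 1 else 0) := by
  have e8 : w.length / 2 / 2 / 2 = w.length / 8 := by omega
  have hmap : ∀ (g : ℕ → ℕ) (l : List ℕ), l.map g = l.flatMap fun v => [g v] := fun g l => by
    induction l <;> simp_all
  have hite : ∀ (c : Prop) (x y : ℕ), (if c then [x] else [y]) = [if c then x else y] := by
    intro c x y; split_ifs <;> rfl
  have hP' := fun a b a' b' => hP (envMem [K, w.length / 8, W, K * K, W * W, a, b, a', b'])
    a b a' b' rfl rfl rfl rfl rfl
  have hO' := fun a b a' b' => hO (envMem [K, w.length / 8, W, K * K, W * W, a, b, a', b'])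
    a b a' b' rfl rfl rfl rfl rfl
  have hZ' := fun a b a' b' => hZ (envMem [K, w.length / 8, W, K * K, W * W, a, b, a', b'])
    a b a' b' rfl rfl rfl rfl rfl
  have v1 : ∀ l, envMem (K :: l) 0 = K := fun _ => rfl
  have v2 : ∀ a l, envMem (K :: a :: l) 1 = a := fun _ _ => rfl
  have v3 : ∀ a b l, envMem (K :: a :: b :: l) 2 = b := fun _ _ _ => rfl
  have v4 : ∀ a b c l, envMem (K :: a :: b :: c :: l) 3 = c := fun _ _ _ _ => rfl
  have v5 : ∀ a b c d l, envMem (K :: a :: b :: c :: d :: l) 4 = d := fun _ _ _ _ _ => rfl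
  have v6 : ∀ a b c d e l, envMem (K :: a :: b :: c :: d :: e :: l) 5 = e :=
    fun _ _ _ _ _ _ => rfl
  have v7 : ∀ a b c d e f l, envMem (K :: a :: b :: c :: d :: e :: f :: l) 6 = f :=
    fun _ _ _ _ _ _ _ => rfl
  simp only [gridProg, EmitProg.out_write, EmitProg.out_seq, EmitProg.out_ite,
    EmitProg.out_letVal, EmitProg.out_letMul, EmitProg.out_loop, holds_gridTermExpr, eval,
    eval_var, List.nil_append, List.cons_append, List.getD_cons_zero, List.length_cons,
    Nat.add_sub_cancel, e8, ← hK, v1, v2, v3, v4, v5, v6, v7, ← hW, hP', hO', hZ', hite]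
  -- On both sides nested loops are merged into a single range, and the quotients and remainders are
  -- matched.
  simp only [flatMap_range_mul, hmap, List.append_assoc, two_mul, Nat.div_div_eq_div_mul,
    Nat.mul_assoc, Nat.mod_mul_left_div_self, Nat.mod_mul_left_mod,
    Nat.mod_mul_right_div_self, Nat.mod_mul_right_mod]

theorem computable_square_add : Computable fun k : ℕ => (k + 1) * (k + 1) + 3 :=
  ((Computable.id.nat_add (Computable.const 1)).nat_mul
    (Computable.id.nat_add (Computable.const 1))).nat_add (Computable.const 3)

/-- Every word is a valid list of rows, so malformed inputs need no separate treatment. The new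
parameter `(k + 1) * (k + 1) + 3` counts the leaves, the roots and `x`. -/
theorem tableauProblem_reducible_out :
    FPTReducible tableauProblem (dsnProblem flawedOutDiamonds) := by
  classical
  refine .of_emitProg (gridProg (gridPatExpr (var 5) (var 6) (var 7) (var 8))
    (gridOneExpr (var 5) (var 6) (var 7) (var 8)) (gridZeroExpr (var 5) (var 6) (var 7) (var 8)))
    (wellScoped_gridProg _ _ _) 10 (fun w k => loopsLE_gridProg _ _ _ w k) computable_square_add
    fun w k => ?_
  obtain ⟨W, hW⟩ : ∃ W, W = w.length / 8 + 3 + (k + 1) := ⟨_, rfl⟩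
  set T : ℕ → ℕ := fun α => (tableauRow w (α - (3 + (k + 1)))).time with hT
  set R : ℕ → ℕ → Prop := fun α β => (tableauRow w (α - (3 + (k + 1)))).LinkCompat
    (tableauRow w (β - (3 + (k + 1)))) (α = β) with hR
  refine ⟨(gridInstance (k + 1) W T R).encode, (k + 1) * (k + 1) + 3, ?_, le_rfl, ?_⟩
  · rw [gridInstance, DSNInstance.encode_ofEntries (W * W) _
      (term := fun u => gridTerm (k + 1) (u / W) (u % W))
      (pat := fun u v => gridPat (k + 1) (u / W) (u % W) (v / W) (v % W))
      fun u v => gridPat_term]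
    refine (out_gridProg (P := gridPat (k + 1)) (O := gridOne (k + 1) T R)
      (Z := gridZero (k + 1)) w k rfl hW ?_ ?_ ?_)
    · rintro m a b a' b' h0 rfl rfl rfl rfl
      rw [holds_gridPatExpr, h0]; rfl
    · rintro m a b a' b' h0 rfl rfl rfl rfl
      rw [holds_gridOneExpr, h0]; rfl
    · rintro m a b a' b' h0 rfl rfl rfl rfl
      rw [holds_gridZeroExpr, h0]; rfl
  · rw [mem_tableauProblem_iff_link hW, ← card_terminals_gridInstance (W := W) (by omega) T R,
      mem_dsnProblem_iff (flawedOutDiamonds_gridInstance (Nat.succ_pos k) (by omega) T R),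
      gridInstance_feasible_iff (Nat.succ_pos k) (by omega)]

/-- The same program with both matrices transposed: the conditions read the second vertex as the
tail. -/
theorem tableauProblem_reducible_in :
    FPTReducible tableauProblem (dsnProblem flawedInDiamonds) := by
  classical
  refine .of_emitProg (gridProg (gridPatExpr (var 7) (var 8) (var 5) (var 6))
    (gridOneExpr (var 7) (var 8) (var 5) (var 6)) (gridZeroExpr (var 7) (var 8) (var 5) (var 6)))
    (wellScoped_gridProg _ _ _) 10 (fun w k => loopsLE_gridProg _ _ _ w k) computable_square_add
    fun w k => ?_
  obtain ⟨W, hW⟩ : ∃ W, W = w.length / 8 + 3 + (k + 1) := ⟨_, rfl⟩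
  set T : ℕ → ℕ := fun α => (tableauRow w (α - (3 + (k + 1)))).time with hT
  set R : ℕ → ℕ → Prop := fun α β => (tableauRow w (α - (3 + (k + 1)))).LinkCompat
    (tableauRow w (β - (3 + (k + 1)))) (α = β) with hR
  refine ⟨(gridInstance (k + 1) W T R).reverse.encode, (k + 1) * (k + 1) + 3, ?_, le_rfl, ?_⟩
  · rw [gridInstance, DSNInstance.reverse_ofEntries,
      DSNInstance.encode_ofEntries (W * W) _
        (term := fun u => gridTerm (k + 1) (u / W) (u % W))
        (pat := fun u v => gridPat (k + 1) (v / W) (v % W) (u / W) (u % W))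
        fun u v h => (gridPat_term h).symm]
    refine (out_gridProg (P := fun a b a' b' => gridPat (k + 1) a' b' a b)
      (O := fun a b a' b' => gridOne (k + 1) T R a' b' a b)
      (Z := fun a b a' b' => gridZero (k + 1) a' b' a b) w k rfl hW ?_ ?_ ?_)
    · rintro m a b a' b' h0 rfl rfl rfl rfl
      rw [holds_gridPatExpr, h0]; rfl
    · rintro m a b a' b' h0 rfl rfl rfl rfl
      rw [holds_gridOneExpr, h0]; rfl
    · rintro m a b a' b' h0 rfl rfl rfl rfl
      rw [holds_gridZeroExpr, h0]; rfl
  · have hc : (gridInstance (k + 1) W T R).reverse.terminals.card = (k + 1) * (k + 1) + 3 :=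
      card_terminals_gridInstance (by omega) T R
    rw [mem_tableauProblem_iff_link hW, ← hc,
      mem_dsnProblem_iff (flawedInDiamonds_reverse_gridInstance (Nat.succ_pos k) (by omega) T R),
      DSNInstance.feasible_reverse, gridInstance_feasible_iff (Nat.succ_pos k) (by omega)]

/-! ## From machines to tableaux -/

/-- The eight numbers of a row. -/
def TableauRow.toList (r : TableauRow) : List ℕ :=
  [r.time, r.state, r.newState, r.read, r.write, r.pos, r.nextPos, r.last]

theorem length_flatMap_toList (rows : List TableauRow) :
    (rows.flatMap TableauRow.toList).length = 8 * rows.length := by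
  induction rows with
  | nil => rfl
  | cons r rows ih =>
    rw [List.flatMap_cons, List.length_append, ih, List.length_cons]
    simp only [TableauRow.toList, List.length_cons, List.length_nil]; omega

theorem tableauRow_flatMap_toList (rows : List TableauRow) (a : ℕ) (ha : a < rows.length) :
    tableauRow (rows.flatMap TableauRow.toList) a = rows[a] := by
  induction rows generalizing a with
  | nil => exact absurd ha (by simp)
  | cons r rows ih =>
    cases a with
    | zero => rfl
    | succ a =>
      rw [List.getElem_cons_succ, ← ih a (by simpa using ha)]
      simp only [tableauRow, List.flatMap_cons, TableauRow.toList, List.cons_append,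
        List.nil_append, Nat.mul_succ]
      rfl

/-- The word consists of the rows with the property `S`, in some order. -/
def ListsRows (o : List ℕ) (S : TableauRow → Prop) : Prop :=
  ∃ rows : List TableauRow, o = rows.flatMap TableauRow.toList ∧ ∀ r, r ∈ rows ↔ S r

namespace ListsRows

variable {o o' : List ℕ} {S S' : TableauRow → Prop}

theorem nil : ListsRows [] fun _ => False := ⟨[], rfl, by simp⟩

theorem toList (r : TableauRow) : ListsRows r.toList fun s => s = r :=
  ⟨[r], by simp, by simp⟩

theorem append (h : ListsRows o S) (h' : ListsRows o' S') :
    ListsRows (o ++ o') fun r => S r ∨ S' r := by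
  obtain ⟨l, rfl, h⟩ := h
  obtain ⟨l', rfl, h'⟩ := h'
  exact ⟨l ++ l', by simp, by simp [h, h']⟩

theorem ite (c : Prop) [Decidable c] (h : c → ListsRows o S) :
    ListsRows (if c then o else []) fun r => c ∧ S r := by
  by_cases hc : c
  · simpa [hc] using h hc
  · simpa [hc] using nil

theorem flatMap {o : ℕ → List ℕ} {S : ℕ → TableauRow → Prop} (n : ℕ)
    (h : ∀ v, ListsRows (o v) (S v)) :
    ListsRows ((List.range n).flatMap o) fun r => ∃ v < n, S v r := by
  choose l hl h using h
  obtain rfl : o = fun v => (l v).flatMap TableauRow.toList := funext hl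
  exact ⟨(List.range n).flatMap l, by simp [List.flatMap_assoc], by simp [h]⟩

theorem mem_tableauProblem_iff (h : ListsRows o S) (k : ℕ) :
    (o, k) ∈ tableauProblem ↔ ∃ r : ℕ → TableauRow, (∀ i ≤ k, S (r i) ∧ (r i).time = i) ∧
      ∀ i j, i < j → j ≤ k → (r i).Compat (r j) := by
  obtain ⟨rows, rfl, hS⟩ := h
  have hlen : (rows.flatMap TableauRow.toList).length / 8 = rows.length := by
    rw [length_flatMap_toList]; omega
  constructor
  · rintro ⟨c, hc, hcomp⟩
    simp only [hlen] at hc hcomp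
    refine ⟨fun i => tableauRow (rows.flatMap TableauRow.toList) (c i), fun i hi => ⟨?_, (hc i hi).2⟩,
      hcomp⟩
    simp only
    rw [tableauRow_flatMap_toList _ _ (hc i hi).1, ← hS]
    exact List.getElem_mem _
  · rintro ⟨r, hr, hcomp⟩
    have : ∀ i, ∃ a, i ≤ k → ∃ h : a < rows.length, rows[a] = r i := by
      intro i
      by_cases hi : i ≤ k
      · obtain ⟨a, ha, e⟩ := List.getElem_of_mem ((hS _).2 (hr i hi).1)
        exact ⟨a, fun _ => ⟨ha, e⟩⟩
      · exact ⟨0, fun h => absurd h hi⟩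
    choose c hc using this
    have hrow : ∀ i ≤ k, tableauRow (rows.flatMap TableauRow.toList) (c i) = r i := by
      intro i hi
      obtain ⟨h1, h2⟩ := hc i hi
      rw [tableauRow_flatMap_toList _ _ h1, h2]
    refine ⟨c, fun i hi => ?_, fun i j hij hj => ?_⟩
    · simp only at hi ⊢
      rw [hlen, hrow i hi]
      exact ⟨(hc i hi).1, (hr i hi).2⟩
    · simp only at hj ⊢
      rw [hrow i (by omega), hrow j hj]
      exact hcomp i j hij hj

end ListsRows

/-! ### Reading a machine and listing its rows -/

/-- The transition number `i` of a word of transitions. -/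
def transitionAt (w : List ℕ) (i : ℕ) : NTMTransition :=
  ⟨w.getD (5 * i) 0, w.getD (5 * i + 1) 0, w.getD (5 * i + 2) 0, w.getD (5 * i + 3) 0,
    w.getD (5 * i + 4) 0⟩

theorem mem_decodeTransitions {w : List ℕ} {τ : NTMTransition} :
    τ ∈ decodeTransitions w ↔ ∃ i, 5 * i + 5 ≤ w.length ∧ τ = transitionAt w i := by
  induction w using decodeTransitions.induct with
  | case1 q a q' b d w ih =>
    rw [decodeTransitions, List.mem_cons, ih]
    constructor
    · rintro (rfl | ⟨i, hi, rfl⟩)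
      · exact ⟨0, by simp, rfl⟩
      · exact ⟨i + 1, by simp only [List.length_cons]; omega, rfl⟩
    · rintro ⟨i, hi, rfl⟩
      cases i with
      | zero => exact Or.inl rfl
      | succ i => exact Or.inr ⟨i, by simp only [List.length_cons] at hi; omega, rfl⟩
  | case2 w h =>
    have hw : w.length < 5 := by
      by_contra hlen
      match w with
      | q :: a :: q' :: b :: d :: w => exact h q a q' b d w rfl
      | [] | [_] | [_, _] | [_, _, _] | [_, _, _, _] => simp at hlen
    rw [decodeTransitions]
    · simp only [List.not_mem_nil, false_iff]
      rintro ⟨i, hi, _⟩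
      omega
    · exact h

/-- The stored length of `x` makes the decomposition of the word unique. -/
theorem mem_shortTMAcceptance_iff {q₀ qₐ l k : ℕ} {w : List ℕ} (hl : l ≤ w.length) :
    (q₀ :: qₐ :: l :: w, k) ∈ shortTMAcceptance ↔
      (NTM.mk q₀ qₐ (decodeTransitions (w.drop l))).AcceptsWithin (w.take l) k := by
  constructor
  · rintro ⟨q, q', x, y, h, hacc⟩
    simp only [List.cons.injEq] at h
    obtain ⟨rfl, rfl, rfl, rfl⟩ := h
    simpa using hacc
  · intro h
    exact ⟨q₀, qₐ, w.take l, w.drop l, by simp [hl], h⟩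

/-- Write several values. -/
def EmitProg.writes : List RAMExpr → EmitProg
  | [] => .skip
  | e :: l => .seq (.write e) (EmitProg.writes l)

theorem EmitProg.out_writes (inp : List ℕ) (l : List RAMExpr) (env : List ℕ) :
    (writes l).out inp env = l.map fun e => e.eval inp (envMem env) := by
  induction l with
  | nil => rfl
  | cons e l ih => rw [writes, out_seq, out_write, ih]; rfl

/-- `offsetExpr` calculates with truth values, so their exact values matter, not only whether they
vanish. -/
theorem RAMExpr.eval_eq (inp : List ℕ) (m : ℕ → ℕ) (a b : RAMExpr) :
    (eq a b).eval inp m = if a.eval inp m = b.eval inp m then 1 else 0 := by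
  simp only [eq, not, eval]; split_ifs <;> omega

/-- The condition for an idle row at the time `t` with position `p`. -/
def idleCond (t p : RAMExpr) : RAMExpr :=
  imp (eq t (.const 0)) (and (eq (.input (.const 2)) (.input (.const 1))) (eq p (.input (.const 0))))

/-- Field `f` of the transition that stands at the position `e` of the input. -/
def transField (e : RAMExpr) (f : ℕ) : RAMExpr := .input (.add e (.const f))

/-- The condition for a row at the time `t` with position `p` and last visit `l` and the
transition at `e`. -/
def stepCond (t p l e : RAMExpr) : RAMExpr :=
  let inside : RAMExpr := and (le (.input (.const 0)) p)
    (lt (.sub p (.input (.const 0))) (.input (.const 3)))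
  and (lt t (.input (.const 0))) <| and (le l t) <| and (le (.add e (.const 5)) .inputLen) <|
  and (imp (eq t (.const 0))
    (and (eq (transField e 0) (.input (.const 1))) (eq p (.input (.const 0))))) <|
  imp (eq l (.const 0)) <|
    or (and inside
        (eq (transField e 1) (.input (.add (.const 4) (.sub p (.input (.const 0)))))))
      (and (not inside) (eq (transField e 1) (.const 0)))

/-- The offset of a transition with a given move. -/
def offsetExpr (d : RAMExpr) : RAMExpr :=
  .add (.sub (.const 1) (eq d (.const 0))) (eq d (.const 1))

/-- The program that writes an idle row. -/
def idleProg : EmitProg :=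
  .ite (idleCond (var 4) (var 5))
    (.writes [var 4, .input (.const 2), .input (.const 2), .const 0, .const 0, var 5,
      .add (var 5) (.const 1), .add (var 4) (.const 1)])
    .skip

/-- The program that writes the row of a transition. -/
def stepProg : EmitProg :=
  .letVal (.add (var 3) (.add (var 7).quad (var 7))) <|
  .ite (stepCond (var 4) (var 5) (var 6) (var 8))
    (.writes [var 4, transField (var 8) 0, transField (var 8) 2, transField (var 8) 1,
      transField (var 8) 3, var 5, .add (var 5) (offsetExpr (transField (var 8) 4)), var 6])
    .skip

/-- The program that writes the rows of the tableaux of a machine. -/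
def tableauProg : EmitProg :=
  -- Variables: 0 is the input length, 1 is `k + 1`, 2 is `2 * k + 1`, 3 the position of the first
  -- transition. The loops add 4 (time), 5 (position), 6 (last visit) and 7 (number of the
  -- transition); `stepProg` adds 8, where that transition stands.
  .letVal .inputLen <| .letVal (.add (.input (.const 0)) (.const 1)) <|
  .letVal (.add (.add (.input (.const 0)) (.input (.const 0))) (.const 1)) <|
  .letVal (.add (.const 4) (.input (.const 3))) <|
  .seq (.write (.input (.const 0))) <|
  .ite (le (var 3) (var 0))
    (.loop 1 <| .loop 2 <| .seq idleProg <| .loop 1 <| .loop 0 stepProg)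
    .skip

theorem wellScoped_tableauProg : tableauProg.WellScoped 0 := by
  simp [tableauProg, idleProg, stepProg, EmitProg.WellScoped, EmitProg.writes]

theorem loopsLE_tableauProg (w : List ℕ) (k : ℕ) :
    tableauProg.LoopsLE (k :: w) ((k + 10) * (wordSize w + 1)) [] := by
  have h := length_le_wordSize w
  have h1 : k + 1 ≤ (k + 10) * (wordSize w + 1) := by nlinarith
  have h2 : w.length + 1 ≤ (k + 10) * (wordSize w + 1) := by nlinarith
  -- For the empty word the bound is only `k + 10`, which may be less than `2 * k + 1`; but then the
  -- test for a well-formed input fails and the loops are not entered.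
  have h3 : k + k + 1 ≤ (k + 10) * (wordSize w + 1) ∨ w = [] := by
    rcases w with _ | ⟨a, w⟩
    · exact Or.inr rfl
    · simp only [List.length_cons] at h; left; nlinarith
  rcases h3 with h3 | rfl
  · simp [tableauProg, idleProg, stepProg, EmitProg.LoopsLE, EmitProg.writes, eval, envMem, var, h1, h2, h3]
  · simp [tableauProg, EmitProg.LoopsLE, eval, envMem, var, le]

section Machine

variable {q₀ qₐ l k : ℕ} {w : List ℕ} {m : ℕ → ℕ}

theorem holds_idleCond {t p : RAMExpr} : (idleCond t p).Holds (k :: q₀ :: qₐ :: l :: w) m ↔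
    (t.eval (k :: q₀ :: qₐ :: l :: w) m = 0 → qₐ = q₀ ∧ p.eval (k :: q₀ :: qₐ :: l :: w) m = k) := by
  simp [idleCond, holds_imp, holds_and, holds_eq, eval]

theorem eval_transField {e : RAMExpr} {i f : ℕ}
    (he : e.eval (k :: q₀ :: qₐ :: l :: w) m = 4 + l + 5 * i) :
    (transField e f).eval (k :: q₀ :: qₐ :: l :: w) m = (w.drop l).getD (5 * i + f) 0 := by
  simp only [transField, eval, he]
  rw [show 4 + l + 5 * i + f = (l + (5 * i + f)) + 1 + 1 + 1 + 1 by omega]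
  simp [List.getD_eq_getElem?_getD]

theorem tape_initial (x : List ℕ) (M : NTM) (p k : ℕ) :
    (M.initial x).tape ((p : ℤ) - k) = if k ≤ p then x.getD (p - k) 0 else 0 := by
  simp only [NTM.initial]
  by_cases h : k ≤ p
  · rw [if_pos (by omega), if_pos h]
    congr 1; omega
  · rw [if_neg (by omega), if_neg h]

/-- The initial tape does not depend on the machine, so `M` is arbitrary. -/
theorem holds_stepCond {M : NTM} {t p s e : RAMExpr} {i : ℕ} (hl : l ≤ w.length)
    (he : e.eval (k :: q₀ :: qₐ :: l :: w) m = 4 + l + 5 * i) :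
    (stepCond t p s e).Holds (k :: q₀ :: qₐ :: l :: w) m ↔
      t.eval (k :: q₀ :: qₐ :: l :: w) m < k ∧
      s.eval (k :: q₀ :: qₐ :: l :: w) m ≤ t.eval (k :: q₀ :: qₐ :: l :: w) m ∧
      5 * i + 5 ≤ (w.drop l).length ∧
      (t.eval (k :: q₀ :: qₐ :: l :: w) m = 0 → (transitionAt (w.drop l) i).state = q₀ ∧
        p.eval (k :: q₀ :: qₐ :: l :: w) m = k) ∧
      (s.eval (k :: q₀ :: qₐ :: l :: w) m = 0 → (transitionAt (w.drop l) i).read =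
        (M.initial (w.take l)).tape ((p.eval (k :: q₀ :: qₐ :: l :: w) m : ℤ) - k)) := by
  simp only [stepCond, holds_and, holds_imp, holds_or, holds_eq, holds_le, holds_lt, holds_not,
    eval_transField he, tape_initial]
  simp only [eval, he, List.length_cons, List.getD_cons_zero, List.length_drop, transitionAt,
    Nat.add_zero]
  generalize p.eval (k :: q₀ :: qₐ :: l :: w) m = p
  have hin : (k :: q₀ :: qₐ :: l :: w).getD 1 0 = q₀ := rfl
  have hin3 : (k :: q₀ :: qₐ :: l :: w).getD 3 0 = l := rfl
  have hx : (k :: q₀ :: qₐ :: l :: w).getD (4 + (p - k)) 0 = w.getD (p - k) 0 := by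
    rw [Nat.add_comm]; rfl
  rw [hin, hin3, hx]
  refine and_congr_right fun _ => and_congr_right fun _ => and_congr (by omega) <|
    and_congr_right fun _ => imp_congr_right fun _ => ?_
  -- The cell lies left of the input, on it, or right of it; outside, the symbol is the blank `0`.
  by_cases h1 : k ≤ p
  · by_cases h2 : p - k < l
    · simp [h1, h2, List.getD_eq_getElem?_getD]
    · simp [h1, h2, List.getD_eq_getElem?_getD]
  · simp [h1]

theorem eval_offsetExpr {e : RAMExpr} {i : ℕ}
    (he : e.eval (k :: q₀ :: qₐ :: l :: w) m = 4 + l + 5 * i) :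
    (offsetExpr (transField e 4)).eval (k :: q₀ :: qₐ :: l :: w) m =
      (transitionAt (w.drop l) i).offset := by
  simp only [offsetExpr, eval, RAMExpr.eval_eq, eval_transField he, NTMTransition.offset,
    transitionAt]
  by_cases h0 : (w.drop l).getD (5 * i + 4) 0 = 0
  · simp only [h0]; rfl
  · by_cases h1 : (w.drop l).getD (5 * i + 4) 0 = 1
    · simp only [h1]; rfl
    · simp only [h0, h1, if_false]

open Classical in
theorem out_idleProg (a b c d t p : ℕ) :
    idleProg.out (k :: q₀ :: qₐ :: l :: w) [a, b, c, d, t, p] =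
      if t = 0 → qₐ = q₀ ∧ p = k then (TableauRow.idle qₐ t p).toList else [] := by
  rw [idleProg, EmitProg.out_ite]
  refine if_congr holds_idleCond ?_ rfl
  rw [EmitProg.out_writes]
  rfl

open Classical in
theorem out_stepProg (M : NTM) (hl : l ≤ w.length) (a b c t p s i : ℕ) :
    stepProg.out (k :: q₀ :: qₐ :: l :: w) [a, b, c, 4 + l, t, p, s, i] =
      if t < k ∧ s ≤ t ∧ 5 * i + 5 ≤ (w.drop l).length ∧
        (t = 0 → (transitionAt (w.drop l) i).state = q₀ ∧ p = k) ∧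
        (s = 0 → (transitionAt (w.drop l) i).read = (M.initial (w.take l)).tape ((p : ℤ) - k))
      then ((transitionAt (w.drop l) i).row t p s).toList else [] := by
  have he : 4 + l + (4 * i + i) = 4 + l + 5 * i := by omega
  rw [stepProg, EmitProg.out_letVal, EmitProg.out_ite]
  have hv : (RAMExpr.add (var 3) (.add (var 7).quad (var 7))).eval (k :: q₀ :: qₐ :: l :: w)
      (envMem [a, b, c, 4 + l, t, p, s, i]) = 4 + l + 5 * i := by
    rw [← he]; simp only [eval, eval_quad]; rfl
  rw [hv]
  have h8 : (var 8).eval (k :: q₀ :: qₐ :: l :: w)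
      (envMem ([a, b, c, 4 + l, t, p, s, i] ++ [4 + l + 5 * i])) = 4 + l + 5 * i := rfl
  refine if_congr (holds_stepCond (M := M) hl h8) ?_ rfl
  rw [EmitProg.out_writes]
  simp only [List.map_cons, List.map_nil, eval_transField h8, eval, eval_offsetExpr h8]
  rfl

/-- This recasts the rows in the shape of the loops of the program. Its ranges for the last visit
and the transition are too generous, and the test cuts them down. -/
theorem isRow_iff {r : TableauRow} (hl : l ≤ w.length) :
    (NTM.mk q₀ qₐ (decodeTransitions (w.drop l))).IsRow (w.take l) k r ↔
    ∃ t < k + 1, ∃ p < k + k + 1, ((t = 0 → qₐ = q₀ ∧ p = k) ∧ r = .idle qₐ t p) ∨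
      ∃ s < k + 1, ∃ i < (k :: q₀ :: qₐ :: l :: w).length,
        (t < k ∧ s ≤ t ∧ 5 * i + 5 ≤ (w.drop l).length ∧
          (t = 0 → (transitionAt (w.drop l) i).state = q₀ ∧ p = k) ∧
          (s = 0 → (transitionAt (w.drop l) i).read =
            ((NTM.mk q₀ qₐ (decodeTransitions (w.drop l))).initial (w.take l)).tape ((p : ℤ) - k))) ∧
        r = (transitionAt (w.drop l) i).row t p s := by
  constructor
  · rintro (⟨t, ht, p, hp, h1, rfl⟩ | ⟨t, ht, p, hp, s, hs, τ, hτ, h1, h2, rfl⟩)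
    · exact ⟨t, by omega, p, by omega, Or.inl ⟨h1, rfl⟩⟩
    · obtain ⟨i, hi, rfl⟩ := mem_decodeTransitions.1 hτ
      refine ⟨t, by omega, p, by omega, Or.inr ⟨s, by omega, i, ?_, ⟨ht, hs, hi, h1, h2⟩, rfl⟩⟩
      simp only [List.length_drop, List.length_cons] at hi ⊢
      omega
  · rintro ⟨t, ht, p, hp, ⟨h1, rfl⟩ | ⟨s, _, i, _, ⟨h1, h2, h3, h4, h5⟩, rfl⟩⟩
    · exact Or.inl ⟨t, by omega, p, by omega, h1, rfl⟩
    · exact Or.inr ⟨t, h1, p, by omega, s, h2, _, mem_decodeTransitions.2 ⟨i, h3, rfl⟩, h4, h5, rfl⟩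

theorem exists_out_tableauProg (hl : l ≤ w.length) :
    ∃ o, tableauProg.out (k :: q₀ :: qₐ :: l :: w) [] = k :: o ∧
      ListsRows o ((NTM.mk q₀ qₐ (decodeTransitions (w.drop l))).IsRow (w.take l) k) := by
  classical
  set M := NTM.mk q₀ qₐ (decodeTransitions (w.drop l)) with hM
  set inp := k :: q₀ :: qₐ :: l :: w with hinp
  have hB : 4 + l ≤ inp.length := by simp only [hinp, List.length_cons]; omega
  have hc : (le (var 3) (var 0)).Holds inp (envMem [inp.length, k + 1, k + k + 1, 4 + l]) := by
    rw [holds_le]; exact hB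
  refine ⟨(EmitProg.loop 1 <| .loop 2 <| .seq idleProg <| .loop 1 <| .loop 0 stepProg).out inp
    [inp.length, k + 1, k + k + 1, 4 + l], ?_, ?_⟩
  · have h : tableauProg.out inp [] = k :: (EmitProg.ite (le (var 3) (var 0))
        (.loop 1 <| .loop 2 <| .seq idleProg <| .loop 1 <| .loop 0 stepProg) .skip).out inp
        [inp.length, k + 1, k + k + 1, 4 + l] := rfl
    rw [h, EmitProg.out_ite, if_pos hc]
  · have hrows := ListsRows.flatMap (k + 1) fun t => ListsRows.flatMap (k + k + 1) fun p =>
      (ListsRows.ite (t = 0 → qₐ = q₀ ∧ p = k) fun _ => .toList (.idle qₐ t p)).append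
      (.flatMap (k + 1) fun s => .flatMap inp.length fun i =>
        .ite (t < k ∧ s ≤ t ∧ 5 * i + 5 ≤ (w.drop l).length ∧
          (t = 0 → (transitionAt (w.drop l) i).state = q₀ ∧ p = k) ∧
          (s = 0 → (transitionAt (w.drop l) i).read =
            (M.initial (w.take l)).tape ((p : ℤ) - k)))
          fun _ => .toList ((transitionAt (w.drop l) i).row t p s))
    have hfun : M.IsRow (w.take l) k = _ := funext fun r => propext (isRow_iff hl)
    rw [hfun]
    refine Eq.mp (congrArg (fun o => ListsRows o _) ?_) hrows
    have e1 : ∀ n, envMem [n, k + 1, k + k + 1, 4 + l] 1 = k + 1 := fun _ => rfl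
    have e2 : ∀ n t, envMem [n, k + 1, k + k + 1, 4 + l, t] 2 = k + k + 1 := fun _ _ => rfl
    have e3 : ∀ n t p, envMem [n, k + 1, k + k + 1, 4 + l, t, p] 1 = k + 1 := fun _ _ _ => rfl
    have e4 : ∀ n t p s, envMem [n, k + 1, k + k + 1, 4 + l, t, p, s] 0 = n :=
      fun _ _ _ _ => rfl
    simp only [EmitProg.out_loop, EmitProg.out_seq, List.cons_append, List.nil_append, e1, e2, e3,
      e4, hinp, out_idleProg, out_stepProg M hl]

end Machine

/-- The parameter is unchanged. A word too short for its header or for the announced length of `x`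
is a no-instance, and the program then writes no rows. -/
theorem shortTMAcceptance_reducible : FPTReducible shortTMAcceptance tableauProblem := by
  refine .of_emitProg tableauProg wellScoped_tableauProg 10 (fun w k => loopsLE_tableauProg w k)
    Computable.id fun w k => ?_
  by_cases hw : ∃ q₀ qₐ l v, w = q₀ :: qₐ :: l :: v ∧ l ≤ v.length
  · obtain ⟨q₀, qₐ, l, v, rfl, hl⟩ := hw
    obtain ⟨o, ho, hrows⟩ := exists_out_tableauProg (q₀ := q₀) (qₐ := qₐ) (k := k) hl
    refine ⟨o, k, ho, le_rfl, ?_⟩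
    rw [mem_shortTMAcceptance_iff hl, hrows.mem_tableauProblem_iff, NTM.acceptsWithin_iff_rows]
  · have hc : ¬ (le (var 3) (var 0)).Holds (k :: w)
        (envMem [(k :: w).length, k + 1, k + k + 1, 4 + (k :: w).getD 3 0]) := by
      rw [holds_le]
      change ¬ (4 + (k :: w).getD 3 0 ≤ (k :: w).length)
      intro h
      apply hw
      match w, h with
      | [], h => simp at h
      | [_], h => simp at h
      | [_, _], h => simp at h
      | q₀ :: qₐ :: l :: v, h =>
        refine ⟨q₀, qₐ, l, v, rfl, ?_⟩
        simp at h
        omega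
    -- The empty list is a no-instance for every `k`, as time `0` always needs a row.
    refine ⟨[], k, ?_, le_rfl, iff_of_false ?_ ?_⟩
    · have h : tableauProg.out (k :: w) [] = k :: (EmitProg.ite (le (var 3) (var 0))
          (.loop 1 <| .loop 2 <| .seq idleProg <| .loop 1 <| .loop 0 stepProg) .skip).out (k :: w)
          [(k :: w).length, k + 1, k + k + 1, 4 + (k :: w).getD 3 0] := rfl
      rw [h, EmitProg.out_ite, if_neg hc, EmitProg.out_skip]
    · rintro ⟨q₀, qₐ, x, y, h, _⟩
      exact hw ⟨q₀, qₐ, x.length, x ++ y, h, by simp⟩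
    · rw [ListsRows.nil.mem_tableauProblem_iff]
      rintro ⟨r, h, _⟩
      exact (h 0 (Nat.zero_le k)).1

theorem mainTheorem9 :
    IsWOneHard (dsnProblem flawedOutDiamonds) ∧ IsWOneHard (dsnProblem flawedInDiamonds) :=
  ⟨fun _ hP => (hP.trans shortTMAcceptance_reducible).trans tableauProblem_reducible_out,
    fun _ hP => (hP.trans shortTMAcceptance_reducible).trans tableauProblem_reducible_in⟩
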